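/- **Setting.** Let $n,T,L\ge 1$ be integers and $\mathcal T=\{s/T : s=0,\dots,T\}$. For each $t\in[0,1]$ let $w^*_t\in\mathbb R^n$ have strictly positive entries; put $b(t)=\max_{i,j} w^*_{t,i}/w^*_{t,j}$, $\pi^*(t)=w^*_t/\sum_i w^*_{t,i}$ and $y^*_{ij}(t)=w^*_{t,j}/(w^*_{t,i}+w^*_{t,j})$. Assume that for some $M\ge 0$, $|y^*_{ij}(t)-y^*_{ij}(t')|\le M|t-t'|$ for all $t,t'\in[0,1]$ and $i\ne j$. Let $G_{t'}=([n],\mathcal E_{t'})$, $t'\in\mathcal T$, be a fixed sequence of simple undirected graphs. For each $t'\in\mathcal T$ and $\{i,j\}\in\mathcal E_{t'}$ we observe $L$ Bernoulli outcomes $y^{(l)}_{ij}(t')$ with $\mathbb P(y^{(l)}_{ij}(t')=1)=y^*_{ij}(t')$ and $y^{(l)}_{ji}(t')=1-y^{(l)}_{ij}(t')$; the outcomes with $i<j$ are independent over all $t'$, $\{i,j\}$ and $l$. Let $y_{ij}(t')=\frac1L\sum_{l=1}^L y^{(l)}_{ij}(t')$. For $t\in[0,1]$ and $\delta\in[\frac12,T]$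 let $\mathcal N_\delta(t)=\{t'\in\mathcal T: |t-t'|\le\delta/T\}$ and $G_\delta(t)=([n],\mathcal E_\delta(t))$ with $\mathcal E_\delta(t)=\bigcup_{t'\in\mathcal N_\delta(t)}\mathcal E_{t'}$, with maximum and minimum degrees $d_{\delta,\max}(t)$ and $d_{\delta,\min}(t)$. Let $\mathcal N_{ij,\delta}(t)=\{t'\in\mathcal N_\delta(t):\{i,j\}\in\mathcal E_{t'}\}$, and let $N_{\max,\delta}(t)$, $N_{\min,\delta}(t)$ be the maximum and minimum of $|\mathcal N_{ij,\delta}(t)|$ over $\{i,j\}\in\mathcal E_\delta(t)$. Suppose that $G_\delta(t)$ has no isolated vertex, i.e. $d_{\delta,\min}(t)>0$; with $A$ its adjacency matrix and $D$ its diagonal degree matrix, let $\lambda_1\ge\dots\ge\lambda_n$ be the (real) eigenvalues of $D^{-1}A$ and $\xi_\delta(t)=1-\max\{\lambda_2,-\lambda_n\}$. For a real number $d_\delta(t)\ge d_{\delta,\max}(t)$ define the matrix $\hat P(t)$ by $\hat P_{ij}(t)=\frac{1}{d_\delta(t)}\bar y_{ij}(t)$ if $\{i,j\}\in\mathcal E_\delta(t)$,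 where $\bar y_{ij}(t)=\frac{1}{|\mathcal N_{ij,\delta}(t)|}\sum_{t'\in\mathcal N_{ij,\delta}(t)}y_{ij}(t')$; $\hat P_{ii}(t)=1-\frac{1}{d_\delta(t)}\sum_{k:\{i,k\}\in\mathcal E_\delta(t)}\bar y_{ik}(t)$; and $\hat P_{ij}(t)=0$ otherwise. The estimate $\hat\pi(t)$ is a stationary distribution of $\hat P(t)$: a probability vector with $\hat\pi(t)^\top\hat P(t)=\hat\pi(t)^\top$. **Theorem.** There are absolute constants $c_1>0$, $\tilde C_1\ge 15$, $\tilde C_2\ge 1$ and $K>0$ such that, in the above setting, for every $t\in[0,1]$, $\delta\in[\frac12,T]$ and $d_\delta(t)\ge d_{\delta,\max}(t)$: if $n\ge c_1\log n$, $\xi_\delta(t)>0$ and $$\tilde C_1\sqrt{\frac{N_{\max,\delta}(t)\,d_{\delta,\max}(t)\log n}{L\,d_\delta(t)^2N_{\min,\delta}(t)^2}}+4\frac{M\delta|\mathcal E_\delta(t)|}{T\,d_{\delta,\max}(t)}\le\frac{\xi_\delta(t)\,d_{\delta,\min}(t)}{8\,d_\delta(t)\,b(t)^{7/2}},$$ then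 $\hat P(t)$ has a stationary distribution, and with probability at least $1-Kn^{-10}$ every stationary distribution $\hat\pi(t)$ of $\hat P(t)$ satisfies $$\frac{\|\hat\pi(t)-\pi^*(t)\|_2}{\|\pi^*(t)\|_2}\le 32\,\frac{M\delta|\mathcal E_\delta(t)|\,b(t)^{7/2}d_\delta(t)}{T\,\xi_\delta(t)\,d_{\delta,\min}(t)\,d_{\delta,\max}(t)}+8\tilde C_2\,\frac{b(t)^{9/2}}{\xi_\delta(t)\,d_{\delta,\min}(t)}\sqrt{\frac{N_{\max,\delta}(t)\,d_{\delta,\max}(t)}{L\,N_{\min,\delta}(t)^2}}.$$ -/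

import Mathlib

open MeasureTheory ProbabilityTheory

noncomputable section

namespace DynRank

/-! ### Dynamic Bradley-Terry-Luce model -/

/-- BTL probability that item `j` beats item `i` under the weights `w`. -/
def btlProb {n : ℕ} (w : Fin n → ℝ) (i j : Fin n) : ℝ := w j / (w i + w j)

/-- The dynamic range `b = max_{i,j} w_i / w_j` of a weight vector. -/
def dynRange {n : ℕ} (w : Fin n → ℝ) : ℝ := ⨆ p : Fin n × Fin n, w p.1 / w p.2

/-- The grid time `s / T`, for `s = 0, …, T`. -/
def gridTime (T : ℕ) (s : Fin (T + 1)) : ℝ := (s : ℕ) / (T : ℝ)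

/-- The weights are positive at all times in `[0,1]`. -/
def PosWeights {n : ℕ} (w : ℝ → Fin n → ℝ) : Prop :=
  ∀ t ∈ Set.Icc (0 : ℝ) 1, ∀ i, 0 < w t i

/-- The pairwise winning probabilities are `M`-Lipschitz in time on `[0,1]`. -/
def LipschitzOutcomes {n : ℕ} (w : ℝ → Fin n → ℝ) (M : ℝ) : Prop :=
  ∀ t ∈ Set.Icc (0 : ℝ) 1, ∀ t' ∈ Set.Icc (0 : ℝ) 1, ∀ i j : Fin n, i ≠ j →
    |btlProb (w t) i j - btlProb (w t') i j| ≤ M * |t - t'|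

/-- `Y s i j l` is the outcome of the `l`-th comparison of `i` and `j` at the grid time `s / T`
(`1` if `j` beats `i`, and `0` if `i` beats `j`), for the pairs compared at that time. All
comparisons (one for each grid time, each unordered compared pair and each `l`) are independent.
The values of `Y` at pairs that are not compared play no role. -/
structure IsBTLSample {Ω : Type*} [MeasurableSpace Ω] (μ : Measure Ω) {n T L : ℕ}
    (w : ℝ → Fin n → ℝ) (G : Fin (T + 1) → SimpleGraph (Fin n))
    (Y : Fin (T + 1) → Fin n → Fin n → Fin L → Ω → ℝ) : Prop where
  measurable : ∀ s i j l, (G s).Adj i j → Measurable (Y s i j l)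
  binary : ∀ s i j l ω, (G s).Adj i j → Y s i j l ω = 0 ∨ Y s i j l ω = 1
  reverse : ∀ s i j l ω, (G s).Adj i j → Y s j i l ω = 1 - Y s i j l ω
  win_prob : ∀ s i j l, (G s).Adj i j →
    μ.real {ω | Y s i j l ω = 1} = btlProb (w (gridTime T s)) i j
  indep : iIndepFun
    (fun (k : {k : Fin (T + 1) × Fin n × Fin n × Fin L //
        k.2.1 < k.2.2.1 ∧ (G k.1).Adj k.2.1 k.2.2.1}) (ω : Ω) =>
      Y k.1.1 k.1.2.1 k.1.2.2.1 k.1.2.2.2 ω) μ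

/-! ### Neighborhoods and the union graph -/

open scoped Classical in
/-- The (indices of the) grid times within distance `δ / T` of `t`. -/
def nbhd (T : ℕ) (δ t : ℝ) : Finset (Fin (T + 1)) :=
  Finset.univ.filter fun s => |t - gridTime T s| ≤ δ / T

/-- The union graph of the comparison graphs at the grid times close to `t`. -/
def unionGraph {n T : ℕ} (G : Fin (T + 1) → SimpleGraph (Fin n)) (δ t : ℝ) :
    SimpleGraph (Fin n) :=
  ⨆ s ∈ nbhd T δ t, G s

open scoped Classical in
/-- The (indices of the) grid times close to `t` at which `i` and `j` are compared. -/
def pairNbhd {n T : ℕ} (G : Fin (T + 1) → SimpleGraph (Fin n)) (δ t : ℝ) (i j : Fin n) :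
    Finset (Fin (T + 1)) :=
  (nbhd T δ t).filter fun s => (G s).Adj i j

/-- The numbers of comparison times of the edges of the union graph. -/
def pairCounts {n T : ℕ} (G : Fin (T + 1) → SimpleGraph (Fin n)) (δ t : ℝ) : Set ℕ :=
  {k | ∃ i j, (unionGraph G δ t).Adj i j ∧ k = (pairNbhd G δ t i j).card}

/-- Largest number of comparison times of an edge of the union graph. -/
def Nmax {n T : ℕ} (G : Fin (T + 1) → SimpleGraph (Fin n)) (δ t : ℝ) : ℕ :=
  sSup (pairCounts G δ t)

/-- Smallest number of comparison times of an edge of the union graph. -/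
def Nmin {n T : ℕ} (G : Fin (T + 1) → SimpleGraph (Fin n)) (δ t : ℝ) : ℕ :=
  sInf (pairCounts G δ t)

open scoped Classical in
/-- Maximum vertex degree. -/
def dMax {n : ℕ} (H : SimpleGraph (Fin n)) : ℕ := H.maxDegree

open scoped Classical in
/-- Minimum vertex degree. -/
def dMin {n : ℕ} (H : SimpleGraph (Fin n)) : ℕ := H.minDegree

open scoped Classical in
/-- Number of edges. -/
def numEdges {n : ℕ} (H : SimpleGraph (Fin n)) : ℕ := H.edgeFinset.card

/-! ### The spectral gap -/

open scoped Classical in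
/-- The random walk matrix `D⁻¹ A` of a graph. -/
def walkMatrix {n : ℕ} (H : SimpleGraph (Fin n)) : Matrix (Fin n) (Fin n) ℝ :=
  Matrix.diagonal (fun i => ((H.degree i : ℝ))⁻¹) * H.adjMatrix ℝ

/-- The real eigenvalues of a matrix, with algebraic multiplicity, in decreasing order. -/
def eigenvaluesDesc {n : ℕ} (A : Matrix (Fin n) (Fin n) ℝ) : List ℝ :=
  A.charpoly.roots.sort (· ≥ ·)

/-- The `k`-th largest eigenvalue `λ_k`, for `k = 1, …, n`, of an `n × n` matrix whose
eigenvalues are all real. -/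
def eigenvalue {n : ℕ} (A : Matrix (Fin n) (Fin n) ℝ) (k : ℕ) : ℝ :=
  (eigenvaluesDesc A).getD (k - 1) 0

/-- The spectral gap `ξ = 1 - max (λ₂, -λ_n)` of the random walk on a graph. -/
def spectralGap {n : ℕ} (H : SimpleGraph (Fin n)) : ℝ :=
  1 - max (eigenvalue (walkMatrix H) 2) (-eigenvalue (walkMatrix H) n)

/-! ### Dynamic Rank Centrality -/

/-- The proportion of wins of `j` over `i` at one time. -/
def winRate {n T L : ℕ} (y : Fin (T + 1) → Fin n → Fin n → Fin L → ℝ)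
    (s : Fin (T + 1)) (i j : Fin n) : ℝ :=
  (1 / (L : ℝ)) * ∑ l : Fin L, y s i j l

/-- The proportion of wins of `j` over `i`, averaged over the times close to `t` at which they
are compared (`0` if there are none). -/
def avgWinRate {n T L : ℕ} (G : Fin (T + 1) → SimpleGraph (Fin n)) (δ t : ℝ)
    (y : Fin (T + 1) → Fin n → Fin n → Fin L → ℝ) (i j : Fin n) : ℝ :=
  (1 / ((pairNbhd G δ t i j).card : ℝ)) * ∑ s ∈ pairNbhd G δ t i j, winRate y s i j

open scoped Classical in
/-- The estimated transition matrix `P̂(t)`, with normalization `d`. -/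
def estMatrix {n T L : ℕ} (G : Fin (T + 1) → SimpleGraph (Fin n)) (δ t d : ℝ)
    (y : Fin (T + 1) → Fin n → Fin n → Fin L → ℝ) : Matrix (Fin n) (Fin n) ℝ :=
  Matrix.of fun i j =>
    if i = j then
      1 - (1 / d) * ∑ k ∈ Finset.univ.filter (fun k => k ≠ i), avgWinRate G δ t y i k
    else if (unionGraph G δ t).Adj i j then avgWinRate G δ t y i j / d
    else 0

/-- `p` is a stationary distribution of the transition matrix `P`: a probability vector that is
a left eigenvector of `P` for the leading eigenvalue `1`. -/
def IsStationary {n : ℕ} (P : Matrix (Fin n) (Fin n) ℝ) (p : Fin n → ℝ) : Prop :=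
  (∀ i, 0 ≤ p i) ∧ ∑ i, p i = 1 ∧ Matrix.vecMul p P = p

/-- The normalized true weights `π*(t) = w / ∑ w_i`. -/
def normalizedWeights {n : ℕ} (w : Fin n → ℝ) : Fin n → ℝ := fun i => w i / ∑ k, w k

/-- The Euclidean norm. -/
def l2norm {n : ℕ} (x : Fin n → ℝ) : ℝ := ‖(WithLp.toLp 2 x : EuclideanSpace ℝ (Fin n))‖

end DynRank

end

noncomputable section

namespace DynRank

set_option linter.unusedSectionVars false

open Matrix Finset

section TraceMoments

variable {ι : Type*} [Fintype ι] [DecidableEq ι]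

/-! ### Symmetric matrices and traces -/

/-! Write q = π*(t) and let p be stationary for P̂(t). Since P̂ is the identity plus 1/d times a
generator, stationarity says that `edgeForm` of the averaged win rates vanishes at (p, v) for every
v (`dotProduct_estMatrix_mulVec`); the normalization d drops out. The rates split as e + ε + β: the
BTL probabilities at time t, for which q is reversible; the centered sampling noise; and the drift
of the probabilities in time, of size Mδ/T. Put x = p - q and test with the density h = x/q. Then
the Dirichlet form of h under e equals ε(x,h) + β(x,h) + ε(q,h) + β(q,h).

On edges q_i e_ij ≥ (min q)/2, so this Dirichlet form dominates that of the random walk on the union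
graph, and the Poincaré inequality `exists_spectralGap_mul_le_dirichlet` bounds it below. The
smallness hypothesis absorbs the two terms containing x; the two terms containing q give the error
(`norm_le_of_dirichlet_le`, `stationary_error_le`).

The noise is needed in two strengths. Its operator norm, which may carry a √(log n), is used only
for the absorption. It comes from trace moments of order m ≈ log n: integration by parts in each
Bernoulli variable gives E tr X^(2p+2) ≤ (2p+1) V E tr X^(2p)
(`integral_trace_centeredSeries_step`). Its action on the fixed vector q enters the final error and
must be free of logarithms. There the square in exp(‖v‖²/τ) is linearized by a Gaussian average and
Hoeffding's lemma is applied to each linear functional (`measure_centered_vector_norm`). -/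

lemma exists_orthogonal_eigenvalues {X : Matrix ι ι ℝ} (hH : X.IsHermitian) :
    ∃ U : Matrix ι ι ℝ, U * Uᵀ = 1 ∧ Uᵀ * U = 1 ∧
      ∀ q : ℕ, X ^ q = U * diagonal (fun i => hH.eigenvalues i ^ q) * Uᵀ := by
  have hU := hH.eigenvectorUnitary.2
  set U : Matrix ι ι ℝ := (hH.eigenvectorUnitary : Matrix ι ι ℝ)
  have hs : star U = Uᵀ := by rw [star_eq_conjTranspose, conjTranspose_eq_transpose_of_trivial]
  have h1 : U * Uᵀ = 1 := by rw [← hs]; exact (mem_unitaryGroup_iff).1 hU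
  have h2 : Uᵀ * U = 1 := by rw [← hs]; exact (mem_unitaryGroup_iff').1 hU
  refine ⟨U, h1, h2, fun q => ?_⟩
  have hX1 : X = U * diagonal hH.eigenvalues * Uᵀ := by
    have := hH.spectral_theorem
    rw [Unitary.conjStarAlgAut_apply] at this
    rw [← hs]
    exact this
  induction q with
  | zero => simp [h1]
  | succ q ih =>
    rw [pow_succ, ih]
    nth_rewrite 2 [hX1]
    calc U * diagonal (fun i => hH.eigenvalues i ^ q) * Uᵀ * (U * diagonal hH.eigenvalues * Uᵀ)
        = U * diagonal (fun i => hH.eigenvalues i ^ q) * (Uᵀ * U) * diagonal hH.eigenvalues * Uᵀ := by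
          simp only [Matrix.mul_assoc]
      _ = _ := by
          rw [h2, Matrix.mul_one, Matrix.mul_assoc U, diagonal_mul_diagonal]
          simp only [pow_succ]

lemma exists_orthogonal_diagonalization {X : Matrix ι ι ℝ} (hX : X.IsSymm) :
    ∃ (U : Matrix ι ι ℝ) (l : ι → ℝ), U * Uᵀ = 1 ∧ Uᵀ * U = 1 ∧
      ∀ q : ℕ, X ^ q = U * diagonal (fun i => l i ^ q) * Uᵀ := by
  have hH : X.IsHermitian := by rw [IsHermitian, conjTranspose_eq_transpose_of_trivial]; exact hX
  obtain ⟨U, hU⟩ := exists_orthogonal_eigenvalues hH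
  exact ⟨U, hH.eigenvalues, hU⟩

lemma dotProduct_pow_mulVec {X U : Matrix ι ι ℝ} {l : ι → ℝ}
    (hU : ∀ q : ℕ, X ^ q = U * diagonal (fun i => l i ^ q) * Uᵀ) (q : ℕ) (u : ι → ℝ) :
    u ⬝ᵥ (X ^ q *ᵥ u) = ∑ i, l i ^ q * (Uᵀ *ᵥ u) i ^ 2 := by
  rw [hU, ← mulVec_mulVec, ← mulVec_mulVec, dotProduct_mulVec, ← mulVec_transpose, dotProduct]
  refine Finset.sum_congr rfl fun i _ => ?_
  rw [mulVec_diagonal]; ring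

/-- B is A written between the eigenbases of X and Y. The weights are nonnegative and do not depend
on q and r, so trace inequalities reduce to scalar ones for the eigenvalues. -/
lemma exists_trace_mul_pow_mul_pow_eq_sum {A X Y : Matrix ι ι ℝ} (hA : A.IsSymm) (hX : X.IsSymm)
    (hY : Y.IsSymm) :
    ∃ (B : ι → ι → ℝ) (a b : ι → ℝ), ∀ q r : ℕ,
      (A * X ^ q * A * Y ^ r).trace = ∑ k, ∑ l, B k l ^ 2 * (a l ^ q * b k ^ r) := by
  obtain ⟨U, a, -, -, hU⟩ := exists_orthogonal_diagonalization hX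
  obtain ⟨V, b, -, -, hV⟩ := exists_orthogonal_diagonalization hY
  refine ⟨fun k l => (Vᵀ * A * U) k l, a, b, fun q r => ?_⟩
  set B := Vᵀ * A * U with hB
  have hBt : Bᵀ = Uᵀ * A * V := by
    simp [hB, Matrix.transpose_mul, hA.eq, Matrix.mul_assoc]
  have : (A * X ^ q * A * Y ^ r).trace =
      (B * diagonal (fun i => a i ^ q) * Bᵀ * diagonal (fun i => b i ^ r)).trace := by
    rw [hU, hV, hBt, hB]
    calc (A * (U * diagonal (fun i => a i ^ q) * Uᵀ) * A * (V * diagonal (fun i => b i ^ r) * Vᵀ)).trace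
        = ((A * U * diagonal (fun i => a i ^ q) * Uᵀ * A * V * diagonal (fun i => b i ^ r)) * Vᵀ).trace := by
          simp only [Matrix.mul_assoc]
      _ = _ := by
          rw [trace_mul_comm]; simp only [Matrix.mul_assoc]
  rw [this, trace]
  refine Finset.sum_congr rfl fun k _ => ?_
  rw [diag_apply, mul_diagonal, mul_apply, Finset.sum_mul]
  refine Finset.sum_congr rfl fun l _ => ?_
  rw [mul_diagonal, transpose_apply]
  ring

lemma pow_mul_pow_le_pow_add_pow (x y : ℝ) {q r : ℕ} (h : Even (q + r)) :
    x ^ q * y ^ r ≤ x ^ (q + r) + y ^ (q + r) := by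
  have h1 : x ^ q * y ^ r ≤ |x| ^ q * |y| ^ r := by
    rw [← abs_pow, ← abs_pow, ← abs_mul]; exact le_abs_self _
  rw [← h.pow_abs x, ← h.pow_abs y]
  refine h1.trans ?_
  rcases le_total |x| |y| with hxy | hxy
  · have : |x| ^ q * |y| ^ r ≤ |y| ^ q * |y| ^ r := by gcongr
    rw [← pow_add] at this
    have h0 : 0 ≤ |x| ^ (q + r) := by positivity
    linarith
  · have : |x| ^ q * |y| ^ r ≤ |x| ^ q * |x| ^ r := by gcongr
    rw [← pow_add] at this
    have h0 : 0 ≤ |y| ^ (q + r) := by positivity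
    linarith

lemma trace_mul_pow_mul_pow_le {A X Y : Matrix ι ι ℝ} (hA : A.IsSymm) (hX : X.IsSymm)
    (hY : Y.IsSymm) {q r : ℕ} (h : Even (q + r)) :
    (A * X ^ q * A * Y ^ r).trace ≤
      (A * A * X ^ (q + r)).trace + (A * A * Y ^ (q + r)).trace := by
  obtain ⟨B, a, b, hB⟩ := exists_trace_mul_pow_mul_pow_eq_sum hA hX hY
  have e1 : (A * A * X ^ (q + r)).trace = (A * X ^ (q + r) * A * Y ^ 0).trace := by
    rw [pow_zero, Matrix.mul_one, Matrix.mul_assoc, trace_mul_comm]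
  have e2 : (A * A * Y ^ (q + r)).trace = (A * X ^ 0 * A * Y ^ (q + r)).trace := by
    rw [pow_zero, Matrix.mul_one]
  rw [e1, e2, hB, hB, hB, ← Finset.sum_add_distrib]
  refine Finset.sum_le_sum fun k _ => ?_
  rw [← Finset.sum_add_distrib]
  refine Finset.sum_le_sum fun l _ => ?_
  rw [← mul_add]
  refine mul_le_mul_of_nonneg_left ?_ (sq_nonneg _)
  simpa using pow_mul_pow_le_pow_add_pow (a l) (b k) h

lemma trace_mul_self_mul_pow_nonneg {A X : Matrix ι ι ℝ} (hA : A.IsSymm) (hX : X.IsSymm)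
    {m : ℕ} (h : Even m) : 0 ≤ (A * A * X ^ m).trace := by
  obtain ⟨B, a, b, hB⟩ := exists_trace_mul_pow_mul_pow_eq_sum hA hX hX
  have e2 : (A * A * X ^ m).trace = (A * X ^ 0 * A * X ^ m).trace := by
    rw [pow_zero, Matrix.mul_one]
  rw [e2, hB]
  refine Finset.sum_nonneg fun k _ => Finset.sum_nonneg fun l _ => ?_
  have := h.pow_nonneg (b k)
  positivity

lemma pow_sub_pow_eq_sum (X Y : Matrix ι ι ℝ) (m : ℕ) :
    X ^ m - Y ^ m = ∑ q ∈ range m, X ^ q * (X - Y) * Y ^ (m - 1 - q) := by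
  induction m with
  | zero => simp
  | succ m ih =>
    rw [Finset.sum_range_succ']
    have : ∑ q ∈ range m, X ^ (q + 1) * (X - Y) * Y ^ (m + 1 - 1 - (q + 1)) =
        X * (X ^ m - Y ^ m) := by
      rw [ih, Finset.mul_sum]
      refine Finset.sum_congr rfl fun q _ => ?_
      rw [pow_succ', show m + 1 - 1 - (q + 1) = m - 1 - q by omega]
      simp only [mul_assoc]
    rw [this]
    simp only [pow_zero, one_mul, Nat.add_sub_cancel, Nat.sub_zero]
    rw [pow_succ', pow_succ']
    noncomm_ring

/-- A mean value inequality under the trace: telescoping produces 2p + 1 terms A X^q A Y^r with q +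
r = 2p, and each is bounded by its two extreme cases. -/
lemma trace_mul_pow_sub_pow_le {A X Y : Matrix ι ι ℝ} (hA : A.IsSymm) (hX : X.IsSymm)
    (hY : Y.IsSymm) (h : X - Y = A) (p : ℕ) :
    (A * (X ^ (2 * p + 1) - Y ^ (2 * p + 1))).trace ≤
      (2 * p + 1) * ((A * A * X ^ (2 * p)).trace + (A * A * Y ^ (2 * p)).trace) := by
  rw [pow_sub_pow_eq_sum, Finset.mul_sum, trace_sum]
  calc ∑ q ∈ range (2 * p + 1), (A * (X ^ q * (X - Y) * Y ^ (2 * p + 1 - 1 - q))).trace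
      ≤ ∑ q ∈ range (2 * p + 1), ((A * A * X ^ (2 * p)).trace + (A * A * Y ^ (2 * p)).trace) := by
        refine Finset.sum_le_sum fun q hq => ?_
        have hq' : q + (2 * p + 1 - 1 - q) = 2 * p := by
          have := Finset.mem_range.1 hq; omega
        have := trace_mul_pow_mul_pow_le hA hX hY (q := q) (r := 2 * p + 1 - 1 - q)
          (by rw [hq']; exact even_two_mul p)
        rw [hq'] at this
        rw [h]
        simpa only [Matrix.mul_assoc] using this
    _ = _ := by simp [mul_add]

/-- The trace form of the bound `∑ A_k² ≤ V` for symmetric matrices `A_k`. -/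
lemma sum_trace_mul_self_mul_pow_le {κ : Type*} [Fintype κ] {A : κ → Matrix ι ι ℝ}
    (hA : ∀ k, (A k).IsSymm) {V : ℝ} (hV : ∀ u : ι → ℝ, ∑ k, (A k *ᵥ u) ⬝ᵥ (A k *ᵥ u) ≤ V * (u ⬝ᵥ u))
    {X : Matrix ι ι ℝ} (hX : X.IsSymm) {m : ℕ} (h : Even m) :
    ∑ k, (A k * A k * X ^ m).trace ≤ V * (X ^ m).trace := by
  obtain ⟨U, l, hU1, hU2, hU⟩ := exists_orthogonal_diagonalization hX
  have key : ∀ B : Matrix ι ι ℝ, B.IsSymm → (B * B * X ^ m).trace =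
      ∑ i, l i ^ m * ((B *ᵥ (fun j => U j i)) ⬝ᵥ (B *ᵥ (fun j => U j i))) := by
    intro B hB
    have : (B * B * X ^ m).trace = (((B * U)ᵀ * (B * U)) * diagonal (fun i => l i ^ m)).trace := by
      rw [hU, Matrix.transpose_mul, hB.eq]
      calc (B * B * (U * diagonal (fun i => l i ^ m) * Uᵀ)).trace
          = (B * B * U * diagonal (fun i => l i ^ m) * Uᵀ).trace := by simp only [Matrix.mul_assoc]
        _ = _ := by rw [trace_mul_comm]; simp only [Matrix.mul_assoc]
    rw [this, trace]
    refine Finset.sum_congr rfl fun i _ => ?_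
    rw [diag_apply, mul_diagonal, mul_comm]
    rfl
  have key1 : (X ^ m).trace = ∑ i, l i ^ m * ((fun j => U j i) ⬝ᵥ (fun j => U j i)) := by
    have := key 1 isSymm_one
    simpa using this
  simp_rw [key _ (hA _)]
  rw [Finset.sum_comm, key1, Finset.mul_sum]
  refine Finset.sum_le_sum fun i _ => ?_
  rw [← Finset.mul_sum]
  have h1 := mul_le_mul_of_nonneg_left (hV (fun j => U j i)) (h.pow_nonneg (l i))
  linarith

lemma trace_even_pow_nonneg {X : Matrix ι ι ℝ} (hX : X.IsSymm) (p : ℕ) :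
    0 ≤ (X ^ (2 * p)).trace := by
  simpa using trace_mul_self_mul_pow_nonneg (A := 1) isSymm_one hX (even_two_mul p)

/-- A trace moment controls the quadratic form of the square. -/
lemma mulVec_dotProduct_mulVec_le_of_trace_pow_le {X : Matrix ι ι ℝ} (hX : X.IsSymm) {p : ℕ}
    (hp : p ≠ 0) {R : ℝ} (hR : 0 ≤ R) (h : (X ^ (2 * p)).trace ≤ R ^ p) (u : ι → ℝ) :
    (X *ᵥ u) ⬝ᵥ (X *ᵥ u) ≤ R * (u ⬝ᵥ u) := by
  obtain ⟨U, l, hU1, hU2, hU⟩ := exists_orthogonal_diagonalization hX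
  have htr : (X ^ (2 * p)).trace = ∑ i, (l i ^ 2) ^ p := by
    rw [hU, Matrix.mul_assoc, trace_mul_comm, Matrix.mul_assoc, hU2, Matrix.mul_one, trace_diagonal]
    simp only [pow_mul]
  -- The trace is a sum of even powers, so it bounds every single eigenvalue.
  have hl : ∀ i, l i ^ 2 ≤ R := by
    intro i
    have h1 : (l i ^ 2) ^ p ≤ R ^ p := by
      refine le_trans ?_ (htr ▸ h)
      exact Finset.single_le_sum (f := fun i => (l i ^ 2) ^ p) (fun j _ => by positivity)
        (Finset.mem_univ i)
    exact le_of_pow_le_pow_left₀ hp hR h1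
  have e := fun q => dotProduct_pow_mulVec hU q u
  have e2 : (X *ᵥ u) ⬝ᵥ (X *ᵥ u) = u ⬝ᵥ (X ^ 2 *ᵥ u) := by
    rw [pow_two, ← mulVec_mulVec, dotProduct_mulVec u, ← mulVec_transpose, hX.eq]
  have e0 : u ⬝ᵥ u = u ⬝ᵥ (X ^ 0 *ᵥ u) := by simp
  rw [e2, e0, e, e, Finset.mul_sum]
  refine Finset.sum_le_sum fun i _ => ?_
  rw [pow_zero, one_mul]
  exact mul_le_mul_of_nonneg_right (hl i) (sq_nonneg _)

end TraceMoments

/-! ### Stationary distributions of stochastic matrices -/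

/-- Row sums 1 make P - 1 singular, so some v ≠ 0 satisfies vP = v. The triangle inequality gives
|v| ≤ |v|P entrywise; both sides have the same total, so equality holds and |v| can be normalized.
-/
lemma exists_isStationary {n : ℕ} [NeZero n] {P : Matrix (Fin n) (Fin n) ℝ}
    (h0 : ∀ i j, 0 ≤ P i j) (h1 : ∀ i, ∑ j, P i j = 1) : ∃ p, IsStationary P p := by
  have hdet : (P - 1).det = 0 := by
    rw [← exists_mulVec_eq_zero_iff]
    refine ⟨fun _ => 1, fun h => one_ne_zero (congrFun h 0), ?_⟩
    ext i
    simp [mulVec, dotProduct, Matrix.sub_apply, Finset.sum_sub_distrib, h1, Matrix.one_apply]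
  obtain ⟨v, hv0, hv⟩ := exists_vecMul_eq_zero_iff.2 hdet
  rw [vecMul_sub, vecMul_one, sub_eq_zero] at hv
  have hle : ∀ j, |v j| ≤ ∑ i, |v i| * P i j := by
    intro j
    nth_rewrite 1 [← hv]
    rw [vecMul, dotProduct]
    refine (Finset.abs_sum_le_sum_abs _ _).trans (le_of_eq ?_)
    refine Finset.sum_congr rfl fun i _ => ?_
    rw [abs_mul, abs_of_nonneg (h0 i j)]
  have hsum : ∑ j, |v j| = ∑ j, ∑ i, |v i| * P i j := by
    rw [Finset.sum_comm]
    simp_rw [← Finset.mul_sum, h1, mul_one]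
  have heq := (Finset.sum_eq_sum_iff_of_le fun j _ => hle j).1 hsum
  have hpos : 0 < ∑ j, |v j| := by
    obtain ⟨j, hj⟩ := Function.ne_iff.1 hv0
    exact lt_of_lt_of_le (abs_pos.2 hj)
      (Finset.single_le_sum (f := fun j => |v j|) (fun _ _ => abs_nonneg _) (Finset.mem_univ j))
  refine ⟨fun i => |v i| / ∑ j, |v j|, fun i => by positivity, ?_, ?_⟩
  · rw [← Finset.sum_div, div_self hpos.ne']
  · ext j
    rw [vecMul, dotProduct, heq j (Finset.mem_univ j), Finset.sum_div]
    refine Finset.sum_congr rfl fun i _ => by ring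

/-! ### Independent binary variables -/

section Binary

variable {Ω : Type*} [MeasurableSpace Ω] {μ : Measure Ω} [IsProbabilityMeasure μ]
  {κ : Type*} [Fintype κ] [DecidableEq κ] {y : κ → Ω → ℝ}

lemma integrable_continuous_comp_binary (hm : ∀ k, Measurable (y k))
    (hb : ∀ k ω, y k ω = 0 ∨ y k ω = 1) {F : (κ → ℝ) → ℝ} (hF : Continuous F) :
    Integrable (fun ω => F (fun k => y k ω)) μ := by
  have hc : IsCompact (Set.Icc (0 : κ → ℝ) 1) := isCompact_Icc
  obtain ⟨C, hC⟩ := hc.exists_bound_of_continuousOn hF.continuousOn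
  refine Integrable.of_bound
    (hF.measurable.comp (measurable_pi_lambda _ hm)).aestronglyMeasurable C (ae_of_all _ fun ω => ?_)
  refine hC _ ⟨fun k => ?_, fun k => ?_⟩ <;> rcases hb k ω with h | h <;> simp [h]

/-- Once coordinate k is frozen at c, the second factor depends only on the other variables, hence
is independent of `y k`. -/
lemma integral_mul_update_of_iIndepFun (hm : ∀ k, Measurable (y k)) (hi : iIndepFun y μ)
    {F : (κ → ℝ) → ℝ} (hF : Continuous F) (k : κ) (c : ℝ) :
    ∫ ω, y k ω * F (Function.update (fun j => y j ω) k c) ∂μ =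
      (∫ ω, y k ω ∂μ) * ∫ ω, F (Function.update (fun j => y j ω) k c) ∂μ := by
  have h := hi.indepFun_finset {k} (univ.erase k) (by simp) hm
  let φ : (({k} : Finset κ) → ℝ) → ℝ := fun z => z ⟨k, by simp⟩
  let ψ : ({j // j ∈ univ.erase k} → ℝ) → ℝ := fun z =>
    F (fun j => if hj : j = k then c else z ⟨j, by simp [hj]⟩)
  have hφ : Measurable φ := measurable_pi_apply _
  have hψ : Measurable ψ := by
    refine hF.measurable.comp (measurable_pi_lambda _ fun j => ?_)
    by_cases hj : j = k
    · simp [hj]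
    · simp only [hj, dite_false]; exact measurable_pi_apply _
  have h2 := h.comp hφ hψ
  have e : (ψ ∘ fun a (i : {j // j ∈ univ.erase k}) => y i a) =
      fun ω => F (Function.update (fun j => y j ω) k c) := by
    ext ω
    simp only [Function.comp, ψ]
    congr 1
    ext j
    by_cases hj : j = k
    · subst hj; simp
    · simp [hj]
  rw [e] at h2
  refine h2.integral_mul_eq_mul_integral (hm k).aestronglyMeasurable ?_
  refine (hF.measurable.comp (measurable_pi_lambda _ fun j => ?_)).aestronglyMeasurable
  by_cases hj : j = k
  · subst hj; simp
  · simpa [hj] using hm j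

lemma continuous_comp_update {F : (κ → ℝ) → ℝ} (hF : Continuous F) (k : κ) (c : ℝ) :
    Continuous fun z : κ → ℝ => F (Function.update z k c) :=
  hF.comp (continuous_id.update k continuous_const)

lemma binary_eq_update (hb : ∀ k ω, y k ω = 0 ∨ y k ω = 1) (F : (κ → ℝ) → ℝ) (k : κ) (ω : Ω) :
    F (fun j => y j ω) = y k ω * F (Function.update (fun j => y j ω) k 1) +
      (F (Function.update (fun j => y j ω) k 0) -
        y k ω * F (Function.update (fun j => y j ω) k 0)) := by
  rcases hb k ω with h | h
  · rw [h, ← h, Function.update_eq_self]; ring_nf; simp [h]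
  · rw [h, ← h, Function.update_eq_self]; simp [h]

lemma integral_eq_update_add_update (hm : ∀ k, Measurable (y k))
    (hb : ∀ k ω, y k ω = 0 ∨ y k ω = 1) (hi : iIndepFun y μ)
    {F : (κ → ℝ) → ℝ} (hF : Continuous F) (k : κ) :
    ∫ ω, F (fun j => y j ω) ∂μ =
      (∫ ω, y k ω ∂μ) * (∫ ω, F (Function.update (fun j => y j ω) k 1) ∂μ) +
      (1 - ∫ ω, y k ω ∂μ) * ∫ ω, F (Function.update (fun j => y j ω) k 0) ∂μ := by
  have i1 : ∀ c, Integrable (fun ω => y k ω * F (Function.update (fun j => y j ω) k c)) μ :=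
    fun c => integrable_continuous_comp_binary hm hb
      ((continuous_apply k).mul (continuous_comp_update hF k c))
  have i2 : Integrable (fun ω => F (Function.update (fun j => y j ω) k 0)) μ :=
    integrable_continuous_comp_binary hm hb (continuous_comp_update hF k 0)
  simp_rw [binary_eq_update hb F k]
  rw [integral_add (i1 1) (by exact i2.sub (i1 0)), integral_sub i2 (i1 0),
    integral_mul_update_of_iIndepFun hm hi hF, integral_mul_update_of_iIndepFun hm hi hF]
  ring

/-- Integration by parts for a Bernoulli variable: the derivative becomes a difference, and the
prefactor is the variance. -/
lemma integral_centered_mul (hm : ∀ k, Measurable (y k))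
    (hb : ∀ k ω, y k ω = 0 ∨ y k ω = 1) (hi : iIndepFun y μ)
    {F : (κ → ℝ) → ℝ} (hF : Continuous F) (k : κ) :
    ∫ ω, (y k ω - ∫ ω', y k ω' ∂μ) * F (fun j => y j ω) ∂μ =
      (∫ ω, y k ω ∂μ) * (1 - ∫ ω, y k ω ∂μ) *
        ∫ ω, (F (Function.update (fun j => y j ω) k 1) -
          F (Function.update (fun j => y j ω) k 0)) ∂μ := by
  have i2 : ∀ c, Integrable (fun ω => F (Function.update (fun j => y j ω) k c)) μ :=
    fun c => integrable_continuous_comp_binary hm hb (continuous_comp_update hF k c)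
  have := integral_eq_update_add_update (F := fun z => (z k - ∫ ω', y k ω' ∂μ) * F z) hm hb hi
    (((continuous_apply k).sub continuous_const).mul hF) k
  simp only [Function.update_self, integral_const_mul] at this
  rw [this, integral_sub (i2 1) (i2 0)]
  ring

lemma integral_binary_mem_Icc (hb : ∀ k ω, y k ω = 0 ∨ y k ω = 1) (k : κ) :
    0 ≤ ∫ ω, y k ω ∂μ ∧ ∫ ω, y k ω ∂μ ≤ 1 := by
  refine ⟨integral_nonneg fun ω => by rcases hb k ω with h | h <;> simp [h], ?_⟩
  by_cases h : Integrable (y k) μ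
  · calc ∫ ω, y k ω ∂μ ≤ ∫ _, (1 : ℝ) ∂μ :=
          integral_mono h (integrable_const _) fun ω => by rcases hb k ω with h | h <;> simp [h]
      _ = 1 := by simp
  -- Measurability is not assumed here; the integral then has the default value 0.
  · rw [integral_undef h]; exact zero_le_one

/-! ### Matrix moments -/

variable {ι : Type*} [Fintype ι] [DecidableEq ι]

/-- The matrix series `∑ (y_k - 𝔼 y_k) S_k`. -/
def centeredSeries (μ : Measure Ω) (y : κ → Ω → ℝ) (S : κ → Matrix ι ι ℝ) (z : κ → ℝ) :
    Matrix ι ι ℝ :=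
  ∑ k, (z k - ∫ ω, y k ω ∂μ) • S k

lemma continuous_centeredSeries (S : κ → Matrix ι ι ℝ) : Continuous (centeredSeries μ y S) := by
  unfold centeredSeries
  fun_prop

lemma isSymm_centeredSeries {S : κ → Matrix ι ι ℝ} (hS : ∀ k, (S k).IsSymm) (z : κ → ℝ) :
    (centeredSeries μ y S z).IsSymm := by
  rw [IsSymm, centeredSeries, transpose_sum]
  simp [(hS _).eq]

lemma centeredSeries_update_sub (S : κ → Matrix ι ι ℝ) (z : κ → ℝ) (k : κ) :
    centeredSeries μ y S (Function.update z k 1) - centeredSeries μ y S (Function.update z k 0) =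
      S k := by
  rw [centeredSeries, centeredSeries, ← Finset.sum_sub_distrib, Finset.sum_eq_single k]
  · rw [← sub_smul]; simp
  · intro j _ hj; simp [hj]
  · simp

/-- One factor X is expanded as its defining sum and each variable is integrated by parts. Flipping
`y k` changes X by exactly `S k`, so the mean value inequality for traces leaves S_k² X^(2p), and
summing over k brings in V. -/
lemma integral_trace_centeredSeries_step (hm : ∀ k, Measurable (y k))
    (hb : ∀ k ω, y k ω = 0 ∨ y k ω = 1) (hi : iIndepFun y μ)
    {S : κ → Matrix ι ι ℝ} (hS : ∀ k, (S k).IsSymm) {V : ℝ}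
    (hV : ∀ u : ι → ℝ, ∑ k, (S k *ᵥ u) ⬝ᵥ (S k *ᵥ u) ≤ V * (u ⬝ᵥ u)) (p : ℕ) :
    ∫ ω, (centeredSeries μ y S (fun k => y k ω) ^ (2 * (p + 1))).trace ∂μ ≤
      (2 * p + 1) * V * ∫ ω, (centeredSeries μ y S (fun k => y k ω) ^ (2 * p)).trace ∂μ := by
  set X := centeredSeries μ y S with hX
  have hc : Continuous X := continuous_centeredSeries S
  have c1 : ∀ (A : Matrix ι ι ℝ) m, Continuous fun z => (A * X z ^ m).trace := fun A m =>
    (continuous_const.mul (hc.pow m)).matrix_trace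
  have hsum : ∀ z, (X z ^ (2 * (p + 1))).trace =
      ∑ k, (z k - ∫ ω', y k ω' ∂μ) * (S k * X z ^ (2 * p + 1)).trace := by
    intro z
    rw [show 2 * (p + 1) = (2 * p + 1) + 1 by ring, pow_succ']
    nth_rewrite 1 [hX]
    rw [centeredSeries, Finset.sum_mul, trace_sum]
    simp [Matrix.trace_smul]
  have hstep : ∀ k, ∫ ω, (y k ω - ∫ ω', y k ω' ∂μ) *
      (S k * X (fun k => y k ω) ^ (2 * p + 1)).trace ∂μ ≤
        (2 * p + 1) * ∫ ω, (S k * S k * X (fun k => y k ω) ^ (2 * p)).trace ∂μ := by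
    intro k
    set q := ∫ ω', y k ω' ∂μ with hq
    obtain ⟨hq0, hq1⟩ : 0 ≤ q ∧ q ≤ 1 := integral_binary_mem_Icc hb k
    have icont : ∀ {F : (κ → ℝ) → ℝ}, Continuous F → ∀ c,
      Integrable (fun ω => F (Function.update (fun j => y j ω) k c)) μ :=
      fun hF c => integrable_continuous_comp_binary hm hb (continuous_comp_update hF k c)
    rw [integral_centered_mul hm hb hi (c1 (S k) (2 * p + 1)) k,
      integral_eq_update_add_update hm hb hi (c1 (S k * S k) (2 * p)) k, ← hq]
    have hnn : ∀ c, 0 ≤ ∫ ω, (S k * S k * X (Function.update (fun j => y j ω) k c) ^ (2 * p)).trace ∂μ :=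
      fun c => integral_nonneg fun ω =>
        trace_mul_self_mul_pow_nonneg (hS k) (isSymm_centeredSeries hS _) (even_two_mul p)
    have h1 : ∫ ω, ((S k * X (Function.update (fun j => y j ω) k 1) ^ (2 * p + 1)).trace -
        (S k * X (Function.update (fun j => y j ω) k 0) ^ (2 * p + 1)).trace) ∂μ ≤
        (2 * p + 1) * ((∫ ω, (S k * S k * X (Function.update (fun j => y j ω) k 1) ^ (2 * p)).trace ∂μ)
          + ∫ ω, (S k * S k * X (Function.update (fun j => y j ω) k 0) ^ (2 * p)).trace ∂μ) := by
      rw [← integral_add (icont (c1 (S k * S k) (2 * p)) 1) (icont (c1 (S k * S k) (2 * p)) 0),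
        ← integral_const_mul]
      refine integral_mono ((icont (c1 (S k) (2 * p + 1)) 1).sub (icont (c1 (S k) (2 * p + 1)) 0))
        (((icont (c1 (S k * S k) (2 * p)) 1).add (icont (c1 (S k * S k) (2 * p)) 0)).const_mul _)
        fun ω => ?_
      have := trace_mul_pow_sub_pow_le (hS k)
        (isSymm_centeredSeries (μ := μ) (y := y) hS (Function.update (fun j => y j ω) k 1))
        (isSymm_centeredSeries (μ := μ) (y := y) hS (Function.update (fun j => y j ω) k 0))
        (centeredSeries_update_sub S _ k) p
      rwa [Matrix.mul_sub, trace_sub] at this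
    have a1 := hnn 1
    have a0 := hnn 0
    set I1 := ∫ ω, (S k * S k * X (Function.update (fun j => y j ω) k 1) ^ (2 * p)).trace ∂μ
    set I0 := ∫ ω, (S k * S k * X (Function.update (fun j => y j ω) k 0) ^ (2 * p)).trace ∂μ
    calc _ ≤ q * (1 - q) * ((2 * p + 1) * (I1 + I0)) :=
          mul_le_mul_of_nonneg_left h1 (mul_nonneg hq0 (by linarith))
      _ = (2 * p + 1) * (q * (1 - q) * I1 + q * (1 - q) * I0) := by ring
      _ ≤ _ := by
          -- The variance q(1 - q) is at most q and at most 1 - q, so the two frozen integrals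
          -- recombine into the full expectation.
          refine mul_le_mul_of_nonneg_left ?_ (by positivity)
          refine add_le_add (mul_le_mul_of_nonneg_right ?_ a1) (mul_le_mul_of_nonneg_right ?_ a0) <;>
          nlinarith
  have ik : ∀ {F : (κ → ℝ) → ℝ}, Continuous F → Integrable (fun ω => F (fun j => y j ω)) μ :=
    fun hF => integrable_continuous_comp_binary hm hb hF
  calc ∫ ω, (X (fun k => y k ω) ^ (2 * (p + 1))).trace ∂μ
      = ∑ k, ∫ ω, (y k ω - ∫ ω', y k ω' ∂μ) *
          (S k * X (fun k => y k ω) ^ (2 * p + 1)).trace ∂μ := by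
        simp_rw [hsum]
        refine integral_finsetSum _ fun k _ => ?_
        exact ik (F := fun z => (z k - ∫ ω', y k ω' ∂μ) * (S k * X z ^ (2 * p + 1)).trace)
          (((continuous_apply k).sub continuous_const).mul (c1 _ _))
    _ ≤ ∑ k, (2 * p + 1) * ∫ ω, (S k * S k * X (fun k => y k ω) ^ (2 * p)).trace ∂μ :=
        Finset.sum_le_sum fun k _ => hstep k
    _ = (2 * p + 1) * ∫ ω, ∑ k, (S k * S k * X (fun k => y k ω) ^ (2 * p)).trace ∂μ := by
        rw [← Finset.mul_sum, integral_finsetSum]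
        exact fun k _ => ik (c1 (S k * S k) (2 * p))
    _ ≤ (2 * p + 1) * ∫ ω, V * (X (fun k => y k ω) ^ (2 * p)).trace ∂μ := by
        refine mul_le_mul_of_nonneg_left (integral_mono ?_ ?_ fun ω => ?_) (by positivity)
        · exact integrable_finsetSum _ fun k _ => ik (c1 (S k * S k) (2 * p))
        · exact (ik (F := fun z => (X z ^ (2 * p)).trace) (hc.pow _).matrix_trace).const_mul V
        · exact sum_trace_mul_self_mul_pow_le hS hV (isSymm_centeredSeries hS _) (even_two_mul p)
    _ = _ := by rw [integral_const_mul]; ring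

/-- Iteration of the step, with every factor 2p + 1 replaced by the uniform bound 2m. -/
lemma integral_trace_centeredSeries_le (hm : ∀ k, Measurable (y k))
    (hb : ∀ k ω, y k ω = 0 ∨ y k ω = 1) (hi : iIndepFun y μ)
    {S : κ → Matrix ι ι ℝ} (hS : ∀ k, (S k).IsSymm) {V : ℝ} (hV0 : 0 ≤ V)
    (hV : ∀ u : ι → ℝ, ∑ k, (S k *ᵥ u) ⬝ᵥ (S k *ᵥ u) ≤ V * (u ⬝ᵥ u)) (m : ℕ) :
    ∀ p ≤ m, ∫ ω, (centeredSeries μ y S (fun k => y k ω) ^ (2 * p)).trace ∂μ ≤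
      (2 * m * V) ^ p * Fintype.card ι := by
  intro p
  induction p with
  | zero => simp
  | succ p ih =>
    intro hp
    refine (integral_trace_centeredSeries_step hm hb hi hS hV p).trans ?_
    have h0 : 0 ≤ ∫ ω, (centeredSeries μ y S (fun k => y k ω) ^ (2 * p)).trace ∂μ :=
      integral_nonneg fun ω => trace_even_pow_nonneg (isSymm_centeredSeries hS _) p
    have hpm : (p : ℝ) + 1 ≤ m := by exact_mod_cast hp
    calc _ ≤ (2 * m * V) * ∫ ω, (centeredSeries μ y S (fun k => y k ω) ^ (2 * p)).trace ∂μ := by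
          refine mul_le_mul_of_nonneg_right (mul_le_mul_of_nonneg_right ?_ hV0) h0
          linarith
      _ ≤ (2 * m * V) * ((2 * m * V) ^ p * Fintype.card ι) :=
          mul_le_mul_of_nonneg_left (ih (by omega)) (by positivity)
      _ = _ := by ring

/-- Concentration of a random matrix series in operator norm. -/
lemma measure_centeredSeries_opNorm (hm : ∀ k, Measurable (y k))
    (hb : ∀ k ω, y k ω = 0 ∨ y k ω = 1) (hi : iIndepFun y μ)
    {S : κ → Matrix ι ι ℝ} (hS : ∀ k, (S k).IsSymm) {V : ℝ} (hV0 : 0 < V)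
    (hV : ∀ u : ι → ℝ, ∑ k, (S k *ᵥ u) ⬝ᵥ (S k *ᵥ u) ≤ V * (u ⬝ᵥ u)) {m : ℕ} (hm0 : m ≠ 0) :
    μ.real {ω | ¬ ∀ u : ι → ℝ, (centeredSeries μ y S (fun k => y k ω) *ᵥ u) ⬝ᵥ
        (centeredSeries μ y S (fun k => y k ω) *ᵥ u) ≤ Real.exp 11 * (2 * m * V) * (u ⬝ᵥ u)} ≤
      Fintype.card ι * Real.exp (-11 * m) := by
  set X := fun ω => centeredSeries μ y S (fun k => y k ω) with hX
  have hm' : (0 : ℝ) < m := by exact_mod_cast Nat.pos_of_ne_zero hm0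
  have hR : 0 < Real.exp 11 * (2 * m * V) := by positivity
  have hsub : {ω | ¬ ∀ u : ι → ℝ, (X ω *ᵥ u) ⬝ᵥ (X ω *ᵥ u) ≤
      Real.exp 11 * (2 * m * V) * (u ⬝ᵥ u)} ⊆
      {ω | (Real.exp 11 * (2 * m * V)) ^ m ≤ (X ω ^ (2 * m)).trace} := by
    intro ω hω
    by_contra hlt
    refine hω fun u => ?_
    exact mulVec_dotProduct_mulVec_le_of_trace_pow_le (isSymm_centeredSeries hS _) hm0 hR.le
      (not_le.1 hlt).le u
  -- At this level Markov's inequality cancels (2mV)^m against the moment bound, leaving e^(-11m)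
  -- times the dimension.
  have hmark := mul_meas_ge_le_integral_of_nonneg (μ := μ) (f := fun ω => (X ω ^ (2 * m)).trace)
    (ae_of_all _ fun ω => trace_even_pow_nonneg (isSymm_centeredSeries hS _) m)
    (integrable_continuous_comp_binary hm hb
      (F := fun z => (centeredSeries μ y S z ^ (2 * m)).trace)
      ((continuous_centeredSeries S).pow _).matrix_trace) ((Real.exp 11 * (2 * m * V)) ^ m)
  have hmom := integral_trace_centeredSeries_le hm hb hi hS hV0.le hV m m le_rfl
  refine (measureReal_mono hsub).trans ?_
  have h1 := hmark.trans hmom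
  simp only [mul_pow (Real.exp 11)] at h1 ⊢
  rw [mul_assoc, mul_comm ((2 * m * V) ^ m) (μ.real _), ← mul_assoc,
    mul_comm _ (Fintype.card ι : ℝ)] at h1
  have h2 := le_of_mul_le_mul_right h1 (by positivity)
  rw [neg_mul, Real.exp_neg, mul_comm (11 : ℝ), Real.exp_nat_mul, ← div_eq_mul_inv,
    le_div_iff₀ (by positivity), mul_comm]
  exact h2

end Binary

/-! ### Norm of a random vector by Gaussian linearization -/

section Gaussian

lemma integral_exp_sq_div_four_gaussianReal :
    Integrable (fun x : ℝ => Real.exp (x ^ 2 / 4)) (gaussianReal 0 1) ∧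
      ∫ x, Real.exp (x ^ 2 / 4) ∂(gaussianReal 0 1) = √2 := by
  have e : ∀ x : ℝ, gaussianPDFReal 0 1 x * Real.exp (x ^ 2 / 4) =
      (√(2 * Real.pi))⁻¹ * Real.exp (-(1 / 4) * x ^ 2) := by
    intro x
    rw [gaussianPDFReal, mul_assoc, ← Real.exp_add]
    simp only [NNReal.coe_one, mul_one]
    congr 2
    ring
  have hint : Integrable (fun x : ℝ => (√(2 * Real.pi))⁻¹ * Real.exp (-(1 / 4) * x ^ 2)) :=
    (integrable_exp_neg_mul_sq (by norm_num)).const_mul _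
  constructor
  · rw [gaussianReal_of_var_ne_zero _ one_ne_zero,
      integrable_withDensity_iff_integrable_smul' (measurable_gaussianPDF 0 1)
        (ae_of_all _ fun _ => gaussianPDF_lt_top)]
    simp only [toReal_gaussianPDF, smul_eq_mul]
    simpa only [e] using hint
  · rw [integral_gaussianReal_eq_integral_smul one_ne_zero]
    simp only [smul_eq_mul, e]
    rw [integral_const_mul, integral_gaussian, ← Real.sqrt_inv, ← Real.sqrt_mul (by positivity)]
    congr 1
    field_simp
    norm_num

variable {Ω : Type*} [MeasurableSpace Ω] {μ : Measure Ω} [IsProbabilityMeasure μ]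
  {κ : Type*} [Fintype κ] [DecidableEq κ] {y : κ → Ω → ℝ}
  {ι : Type*} [Fintype ι] [DecidableEq ι]

lemma integral_exp_dotProduct_gaussian (u : ι → ℝ) :
    Integrable (fun g : ι → ℝ => Real.exp (g ⬝ᵥ u)) (Measure.pi fun _ => gaussianReal 0 1) ∧
    ∫ g : ι → ℝ, Real.exp (g ⬝ᵥ u) ∂(Measure.pi fun _ => gaussianReal 0 1) =
      Real.exp (u ⬝ᵥ u / 2) := by
  have e : (fun g : ι → ℝ => Real.exp (g ⬝ᵥ u)) = fun g => ∏ i, Real.exp (u i * g i) := by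
    ext g
    rw [← Real.exp_sum, dotProduct]
    simp only [mul_comm]
  rw [e]
  constructor
  · exact Integrable.fintype_prod (f := fun i x => Real.exp (u i * x))
      fun i => integrable_exp_mul_gaussianReal (u i)
  · rw [integral_fintype_prod_eq_prod (f := fun i x => Real.exp (u i * x))]
    have : ∀ i, ∫ x, Real.exp (u i * x) ∂(gaussianReal 0 1) = Real.exp (u i * u i / 2) := by
      intro i
      have := mgf_gaussianReal (p := gaussianReal 0 1) (X := id) (μ := 0) (v := 1) (by simp) (u i)
      rw [mgf] at this
      simpa [pow_two] using this
    simp_rw [this]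
    rw [← Real.exp_sum, dotProduct, Finset.sum_div]

lemma integral_exp_dotProduct_div_four_gaussian :
    Integrable (fun g : ι → ℝ => Real.exp (g ⬝ᵥ g / 4)) (Measure.pi fun _ => gaussianReal 0 1) ∧
    ∫ g : ι → ℝ, Real.exp (g ⬝ᵥ g / 4) ∂(Measure.pi fun _ => gaussianReal 0 1) ≤
      Real.exp (Fintype.card ι) := by
  have e : (fun g : ι → ℝ => Real.exp (g ⬝ᵥ g / 4)) = fun g => ∏ i, Real.exp (g i ^ 2 / 4) := by
    ext g
    rw [← Real.exp_sum, dotProduct, Finset.sum_div]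
    simp only [pow_two]
  rw [e]
  constructor
  · exact Integrable.fintype_prod (f := fun _ x => Real.exp (x ^ 2 / 4))
      fun i => integral_exp_sq_div_four_gaussianReal.1
  · rw [integral_fintype_prod_eq_prod (f := fun _ x => Real.exp (x ^ 2 / 4))]
    simp_rw [integral_exp_sq_div_four_gaussianReal.2]
    rw [Finset.prod_const, Finset.card_univ, ← Real.exp_one_pow]
    refine pow_le_pow_left₀ (Real.sqrt_nonneg _) ?_ _
    have := Real.add_one_le_exp (1 : ℝ)
    have h2 : √2 ≤ 2 := Real.sqrt_le_iff.2 ⟨by norm_num, by norm_num⟩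
    linarith

/-- Hoeffding's lemma: a centered variable with values in an interval of length 1 is sub-Gaussian
with parameter 1/4. -/
lemma integral_exp_centered_sum_le (hm : ∀ k, Measurable (y k))
    (hb : ∀ k ω, y k ω = 0 ∨ y k ω = 1) (hi : iIndepFun y μ) (c : κ → ℝ) :
    Integrable (fun ω => Real.exp (∑ k, c k * (y k ω - ∫ ω', y k ω' ∂μ))) μ ∧
    ∫ ω, Real.exp (∑ k, c k * (y k ω - ∫ ω', y k ω' ∂μ)) ∂μ ≤
      Real.exp ((∑ k, c k ^ 2) / 8) := by
  have hsub : ∀ k, HasSubgaussianMGF (fun ω => c k * (y k ω - ∫ ω', y k ω' ∂μ))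
      (c k ^ 2 / 4).toNNReal μ := by
    intro k
    convert (hasSubgaussianMGF_of_mem_Icc (μ := μ) (a := 0) (b := 1) (hm k).aemeasurable
      (ae_of_all _ fun ω => by rcases hb k ω with h | h <;> simp [h])).const_mul (c k) using 1
    apply NNReal.eq
    rw [Real.coe_toNNReal _ (by positivity)]
    change c k ^ 2 / 4 = c k ^ 2 * (‖(1 : ℝ) - 0‖ / 2) ^ 2
    norm_num
    ring
  have hind : iIndepFun (fun k ω => c k * (y k ω - ∫ ω', y k ω' ∂μ)) μ :=
    hi.comp (fun k z => c k * (z - ∫ ω', y k ω' ∂μ)) fun k => by fun_prop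
  have h := HasSubgaussianMGF.sum_of_iIndepFun hind (s := univ) fun k _ => hsub k
  constructor
  · simpa using h.integrable_exp_mul 1
  · have := h.mgf_le 1
    rw [mgf] at this
    simp only [one_mul] at this
    refine this.trans (le_of_eq ?_)
    congr 1
    rw [NNReal.coe_sum]
    simp_rw [fun k => Real.coe_toNNReal (c k ^ 2 / 4) (by positivity)]
    rw [← Finset.sum_div]
    ring

/-- Concentration of the norm of a random vector `∑ (y_k - 𝔼 y_k) a_k`. -/
lemma measure_centered_vector_norm (hm : ∀ k, Measurable (y k))
    (hb : ∀ k ω, y k ω = 0 ∨ y k ω = 1) (hi : iIndepFun y μ) {a : κ → ι → ℝ} {τ : ℝ} (hτ : 0 < τ)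
    (ha : ∀ g : ι → ℝ, ∑ k, (g ⬝ᵥ a k) ^ 2 ≤ τ * (g ⬝ᵥ g)) {v : Ω → ι → ℝ}
    (hv : ∀ ω, v ω = ∑ k, (y k ω - ∫ ω', y k ω' ∂μ) • a k) :
    μ.real {ω | 11 * Fintype.card ι * τ ≤ v ω ⬝ᵥ v ω} ≤ Real.exp (-10 * Fintype.card ι) := by
  set N : ℝ := (Fintype.card ι : ℝ)
  set γ : Measure (ι → ℝ) := Measure.pi fun _ => gaussianReal 0 1
  -- Chosen so that the Gaussian average of exp(θ g·v) is exp(‖v‖²/τ).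
  set θ : ℝ := √(2 / τ) with hθ
  have hθ2 : θ ^ 2 = 2 / τ := Real.sq_sqrt (by positivity)
  have hvm : ∀ i, Measurable fun ω => v ω i := by
    intro i
    simp only [hv, Finset.sum_apply, Pi.smul_apply, smul_eq_mul]
    fun_prop
  have e1 : ∀ ω, ENNReal.ofReal (Real.exp (v ω ⬝ᵥ v ω / τ)) =
      ∫⁻ g, ENNReal.ofReal (Real.exp (g ⬝ᵥ (θ • v ω))) ∂γ := by
    intro ω
    rw [← ofReal_integral_eq_lintegral_ofReal (integral_exp_dotProduct_gaussian _).1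
      (ae_of_all _ fun _ => (Real.exp_pos _).le), (integral_exp_dotProduct_gaussian _).2]
    congr 2
    rw [smul_dotProduct, dotProduct_smul, smul_eq_mul, smul_eq_mul, ← mul_assoc, ← pow_two, hθ2]
    ring
  -- The exponent θ²τ‖g‖²/8 = ‖g‖²/4 is still integrable against the Gaussian density.
  have e2 : ∀ g : ι → ℝ, ∫⁻ ω, ENNReal.ofReal (Real.exp (g ⬝ᵥ (θ • v ω))) ∂μ ≤
      ENNReal.ofReal (Real.exp (g ⬝ᵥ g / 4)) := by
    intro g
    have e : ∀ ω, g ⬝ᵥ (θ • v ω) = ∑ k, (θ * (g ⬝ᵥ a k)) * (y k ω - ∫ ω', y k ω' ∂μ) := by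
      intro ω
      rw [hv, dotProduct_smul, dotProduct_sum, smul_eq_mul, Finset.mul_sum]
      refine Finset.sum_congr rfl fun k _ => ?_
      rw [dotProduct_smul, smul_eq_mul]; ring
    simp_rw [e]
    obtain ⟨h1, h2⟩ := integral_exp_centered_sum_le hm hb hi fun k => θ * (g ⬝ᵥ a k)
    rw [← ofReal_integral_eq_lintegral_ofReal h1 (ae_of_all _ fun _ => (Real.exp_pos _).le)]
    refine ENNReal.ofReal_le_ofReal (h2.trans (Real.exp_le_exp.2 ?_))
    simp_rw [mul_pow, ← Finset.mul_sum, hθ2]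
    calc 2 / τ * (∑ k, (g ⬝ᵥ a k) ^ 2) / 8 ≤ 2 / τ * (τ * (g ⬝ᵥ g)) / 8 := by
          gcongr; exact ha g
      _ = g ⬝ᵥ g / 4 := by field_simp; ring
  have hmeas : Measurable (Function.uncurry fun (ω : Ω) (g : ι → ℝ) =>
      ENNReal.ofReal (Real.exp (g ⬝ᵥ (θ • v ω)))) := by
    refine ENNReal.measurable_ofReal.comp (Real.measurable_exp.comp ?_)
    simp only [dotProduct, Pi.smul_apply, smul_eq_mul]
    refine Finset.measurable_sum _ fun i _ => ?_
    exact ((measurable_pi_apply i).comp measurable_snd).mul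
      (((hvm i).comp measurable_fst).const_mul θ)
  have hexp : ∫⁻ ω, ENNReal.ofReal (Real.exp (v ω ⬝ᵥ v ω / τ)) ∂μ ≤ ENNReal.ofReal (Real.exp N) := by
    simp_rw [e1]
    rw [lintegral_lintegral_swap hmeas.aemeasurable]
    refine (lintegral_mono e2).trans ?_
    rw [← ofReal_integral_eq_lintegral_ofReal integral_exp_dotProduct_div_four_gaussian.1
      (ae_of_all _ fun _ => (Real.exp_pos _).le)]
    exact ENNReal.ofReal_le_ofReal integral_exp_dotProduct_div_four_gaussian.2
  have hvv : Measurable fun ω => ENNReal.ofReal (Real.exp (v ω ⬝ᵥ v ω / τ)) := by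
    refine ENNReal.measurable_ofReal.comp (Real.measurable_exp.comp ?_)
    simp only [dotProduct]
    fun_prop
  -- The exponential moment is at most e^N, so the level e^(11N) leaves probability e^(-10N).
  have hmark := (mul_meas_ge_le_lintegral hvv (ENNReal.ofReal (Real.exp (11 * N)))).trans hexp
  have hset : {ω | 11 * N * τ ≤ v ω ⬝ᵥ v ω} = {ω | ENNReal.ofReal (Real.exp (11 * N)) ≤
      ENNReal.ofReal (Real.exp (v ω ⬝ᵥ v ω / τ))} := by
    ext ω
    simp only [Set.mem_ofPred_eq]
    rw [ENNReal.ofReal_le_ofReal_iff (Real.exp_pos _).le, Real.exp_le_exp, le_div_iff₀ hτ]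
  rw [hset]
  set s := {ω | ENNReal.ofReal (Real.exp (11 * N)) ≤ ENNReal.ofReal (Real.exp (v ω ⬝ᵥ v ω / τ))}
  have h3 := ENNReal.toReal_mono ENNReal.ofReal_ne_top hmark
  rw [ENNReal.toReal_mul, ENNReal.toReal_ofReal (Real.exp_pos _).le,
    ENNReal.toReal_ofReal (Real.exp_pos _).le, ← measureReal_def] at h3
  have h4 : Real.exp N = Real.exp (11 * N) * Real.exp (-10 * N) := by
    rw [← Real.exp_add]; congr 1; ring
  rw [h4] at h3
  exact le_of_mul_le_mul_left h3 (Real.exp_pos _)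

end Gaussian

/-! ### Spectral gap and Poincaré inequality -/

section SpectralGap

variable {n : ℕ}

open scoped Classical in
/-- The symmetrization `D^{-1/2} A D^{-1/2}` of the random walk matrix. -/
def symWalkMatrix (H : SimpleGraph (Fin n)) : Matrix (Fin n) (Fin n) ℝ :=
  diagonal (fun i => (√(H.degree i))⁻¹) * H.adjMatrix ℝ * diagonal (fun i => (√(H.degree i))⁻¹)

lemma isHermitian_symWalkMatrix (H : SimpleGraph (Fin n)) : (symWalkMatrix H).IsHermitian := by
  classical
  rw [IsHermitian, conjTranspose_eq_transpose_of_trivial, symWalkMatrix]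
  simp [Matrix.transpose_mul, Matrix.mul_assoc]

/-- The products MN and NM have the same characteristic polynomial, with M = D^(-1/2) and N =
D^(-1/2) A. Hence the gap, defined by roots, can be read off a symmetric matrix. -/
lemma charpoly_walkMatrix (H : SimpleGraph (Fin n)) :
    (walkMatrix H).charpoly = (symWalkMatrix H).charpoly := by
  classical
  have : walkMatrix H = diagonal (fun i => (√(H.degree i))⁻¹) *
      (diagonal (fun i => (√(H.degree i))⁻¹) * H.adjMatrix ℝ) := by
    rw [walkMatrix, ← Matrix.mul_assoc, diagonal_mul_diagonal]
    congr 2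
    ext i
    rw [← mul_inv, Real.mul_self_sqrt (Nat.cast_nonneg _)]
  rw [this, charpoly_mul_comm, symWalkMatrix]

lemma exists_eigenvalues_symWalkMatrix_le (H : SimpleGraph (Fin n)) (hn : 2 ≤ n) :
    ∃ k₀, ∀ k ≠ k₀, (isHermitian_symWalkMatrix H).eigenvalues k ≤ 1 - spectralGap H := by
  set hH := isHermitian_symWalkMatrix H
  have hlist : eigenvaluesDesc (walkMatrix H) = List.ofFn hH.eigenvalues₀ := by
    rw [eigenvaluesDesc, charpoly_walkMatrix, ← hH.sort_roots_charpoly_eq_eigenvalues₀]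
    congr 1
    exact (Multiset.map_id' _).symm
  have hcard : 1 < Fintype.card (Fin n) := by simp; omega
  -- The second eigenvalue sits at index 2 - 1; since n ≥ 2 the list default 0 does not intervene.
  have h2 : eigenvalue (walkMatrix H) 2 = hH.eigenvalues₀ ⟨1, hcard⟩ := by
    rw [eigenvalue, hlist, List.getD_eq_getElem _ _ (by simp; omega)]
    simp
  -- This is the reindexing that relates `eigenvalues` to the sorted `eigenvalues₀`; the exceptional
  -- index is that of the largest eigenvalue.
  let e : Fin (Fintype.card (Fin n)) ≃ Fin n := Fintype.equivOfCardEq (Fintype.card_fin _)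
  refine ⟨e ⟨0, by omega⟩, fun k hk => ?_⟩
  have hk' : (⟨1, hcard⟩ : Fin (Fintype.card (Fin n))) ≤ e.symm k := by
    rw [Fin.le_def]
    have : e.symm k ≠ ⟨0, by omega⟩ := fun h => hk (by rw [← h, Equiv.apply_symm_apply])
    have h0 : (e.symm k : ℕ) ≠ 0 := fun h => this (Fin.ext h)
    show 1 ≤ (e.symm k : ℕ)
    omega
  have h3 : hH.eigenvalues k ≤ hH.eigenvalues₀ ⟨1, hcard⟩ := hH.eigenvalues₀_antitone hk'
  rw [← h2] at h3
  have := le_max_left (eigenvalue (walkMatrix H) 2) (-eigenvalue (walkMatrix H) n)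
  rw [spectralGap]
  linarith

open scoped Classical in
lemma dirichlet_eq (H : SimpleGraph (Fin n)) (hdeg : ∀ i, 0 < H.degree i) (h : Fin n → ℝ) :
    (∑ i, ∑ j, H.adjMatrix ℝ i j * (h i - h j) ^ 2) / 2 =
      (fun i => √(H.degree i) * h i) ⬝ᵥ (fun i => √(H.degree i) * h i) -
      (fun i => √(H.degree i) * h i) ⬝ᵥ (symWalkMatrix H *ᵥ fun i => √(H.degree i) * h i) := by
  have hd : ∀ i, (H.degree i : ℝ) = ∑ j, H.adjMatrix ℝ i j := by
    intro i
    simp [SimpleGraph.adjMatrix_apply, ← SimpleGraph.card_neighborFinset_eq_degree,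
      SimpleGraph.neighborFinset_eq_filter]
  have e1 : (fun i => √(H.degree i) * h i) ⬝ᵥ (fun i => √(H.degree i) * h i) =
      ∑ i, ∑ j, H.adjMatrix ℝ i j * h i ^ 2 := by
    rw [dotProduct]
    refine Finset.sum_congr rfl fun i _ => ?_
    rw [← Finset.sum_mul, ← hd, mul_mul_mul_comm, Real.mul_self_sqrt (Nat.cast_nonneg _), pow_two]
  have e1' : ∑ i, ∑ j, H.adjMatrix ℝ i j * h i ^ 2 = ∑ i, ∑ j, H.adjMatrix ℝ i j * h j ^ 2 := by
    rw [Finset.sum_comm]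
    refine Finset.sum_congr rfl fun i _ => Finset.sum_congr rfl fun j _ => ?_
    rw [← H.isSymm_adjMatrix.apply i j]
  have e2 : (fun i => √(H.degree i) * h i) ⬝ᵥ (symWalkMatrix H *ᵥ fun i => √(H.degree i) * h i) =
      ∑ i, ∑ j, H.adjMatrix ℝ i j * (h i * h j) := by
    rw [dotProduct]
    refine Finset.sum_congr rfl fun i _ => ?_
    rw [mulVec, dotProduct, Finset.mul_sum]
    refine Finset.sum_congr rfl fun j _ => ?_
    have hi : √(H.degree i : ℝ) ≠ 0 := (Real.sqrt_pos.2 (by exact_mod_cast hdeg i)).ne'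
    have hj : √(H.degree j : ℝ) ≠ 0 := (Real.sqrt_pos.2 (by exact_mod_cast hdeg j)).ne'
    have : symWalkMatrix H i j = (√(H.degree i))⁻¹ * H.adjMatrix ℝ i j * (√(H.degree j))⁻¹ := by
      rw [symWalkMatrix, mul_diagonal, diagonal_mul]
    rw [this]
    field_simp
  have e3 : ∑ i, ∑ j, H.adjMatrix ℝ i j * (h i - h j) ^ 2 =
      ∑ i, ∑ j, H.adjMatrix ℝ i j * h i ^ 2 + ∑ i, ∑ j, H.adjMatrix ℝ i j * h j ^ 2 -
      2 * ∑ i, ∑ j, H.adjMatrix ℝ i j * (h i * h j) := by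
    simp only [Finset.mul_sum, ← Finset.sum_add_distrib, ← Finset.sum_sub_distrib]
    refine Finset.sum_congr rfl fun i _ => Finset.sum_congr rfl fun j _ => by ring
  rw [e3, e1, e2, ← e1']
  ring

open scoped Classical in
/-- The Poincaré inequality of the random walk on a graph. -/
lemma exists_spectralGap_mul_le_dirichlet (H : SimpleGraph (Fin n)) (hn : 2 ≤ n)
    (hdeg : ∀ i, 0 < H.degree i) (hξ : 0 < spectralGap H) (h : Fin n → ℝ) :
    ∃ c : ℝ, spectralGap H * ∑ i, H.degree i * (h i - c) ^ 2 ≤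
      (∑ i, ∑ j, H.adjMatrix ℝ i j * (h i - h j) ^ 2) / 2 := by
  set hH := isHermitian_symWalkMatrix H
  obtain ⟨k₀, hk₀⟩ := exists_eigenvalues_symWalkMatrix_le H hn
  obtain ⟨U, -, -, hU⟩ := exists_orthogonal_eigenvalues hH
  let a : (Fin n → ℝ) → Fin n → ℝ := fun f => Uᵀ *ᵥ fun i => √(H.degree i) * f i
  have hsq : ∀ f : Fin n → ℝ, ∑ i, H.degree i * f i ^ 2 = ∑ k, a f k ^ 2 := by
    intro f
    have h0 := dotProduct_pow_mulVec hU 0 (fun i => √(H.degree i) * f i)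
    simp only [pow_zero, one_mulVec, one_mul] at h0
    rw [← h0, dotProduct]
    refine Finset.sum_congr rfl fun i _ => ?_
    rw [mul_mul_mul_comm, Real.mul_self_sqrt (Nat.cast_nonneg _), pow_two]
  have hD : ∀ f : Fin n → ℝ, (∑ i, ∑ j, H.adjMatrix ℝ i j * (f i - f j) ^ 2) / 2 =
      ∑ k, (1 - hH.eigenvalues k) * a f k ^ 2 := by
    intro f
    have h0 := dotProduct_pow_mulVec hU 0 (fun i => √(H.degree i) * f i)
    have h1 := dotProduct_pow_mulVec hU 1 (fun i => √(H.degree i) * f i)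
    simp only [pow_zero, one_mulVec, one_mul] at h0
    simp only [pow_one] at h1
    rw [dirichlet_eq H hdeg, h0, h1, ← Finset.sum_sub_distrib]
    exact Finset.sum_congr rfl fun k _ => by simp only [a]; ring
  have hgap : ∀ f : Fin n → ℝ, a f k₀ = 0 → spectralGap H * ∑ i, H.degree i * f i ^ 2 ≤
      (∑ i, ∑ j, H.adjMatrix ℝ i j * (f i - f j) ^ 2) / 2 := by
    intro f hf
    rw [hD, hsq, Finset.mul_sum]
    refine Finset.sum_le_sum fun k _ => ?_
    by_cases hk : k = k₀
    · rw [hk, hf]; simp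
    · exact mul_le_mul_of_nonneg_right (by linarith [hk₀ k hk]) (sq_nonneg _)
  -- The constant function has zero Dirichlet energy, so it cannot satisfy the gap inequality and
  -- must have a component along `k₀`. Subtracting a multiple of it kills that component of h,
  -- without identifying the top eigenvector.
  have ha1 : a (fun _ => 1) k₀ ≠ 0 := by
    intro h0
    have := hgap _ h0
    simp only [sub_self, ne_eq, OfNat.ofNat_ne_zero, not_false_eq_true, zero_pow, mul_zero,
      Finset.sum_const_zero, zero_div, one_pow, mul_one] at this
    have hpos : 0 < ∑ i, (H.degree i : ℝ) :=
      Finset.sum_pos (fun i _ => by exact_mod_cast hdeg i) ⟨⟨0, by omega⟩, Finset.mem_univ _⟩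
    nlinarith
  refine ⟨a h k₀ / a (fun _ => 1) k₀, ?_⟩
  set c := a h k₀ / a (fun _ => 1) k₀ with hc
  have hlin : a (fun i => h i - c) = a h - c • a (fun _ => 1) := by
    simp only [a]
    rw [← mulVec_smul, ← mulVec_sub]
    congr 1
    ext i
    simp only [Pi.sub_apply, Pi.smul_apply, smul_eq_mul]
    ring
  have := hgap (fun i => h i - c) (by
    rw [hlin, Pi.sub_apply, Pi.smul_apply, smul_eq_mul, hc, div_mul_cancel₀ _ ha1, sub_self])
  simpa using this

end SpectralGap

/-! ### The bilinear form of a generator -/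

section EdgeForm

variable {n : ℕ}

/-- The bilinear form `(u, v) ↦ uᵀ (Q - D) v`, where `Q` has the off-diagonal entries `e` and `D` is
the diagonal matrix of its row sums. -/
def edgeForm (e : Fin n → Fin n → ℝ) (u v : Fin n → ℝ) : ℝ :=
  ∑ i, ∑ j, e i j * (u i * (v j - v i))

lemma edgeForm_add_weight (e f : Fin n → Fin n → ℝ) (u v : Fin n → ℝ) :
    edgeForm (e + f) u v = edgeForm e u v + edgeForm f u v := by
  simp only [edgeForm, Pi.add_apply, add_mul, Finset.sum_add_distrib]

lemma edgeForm_add_left (e : Fin n → Fin n → ℝ) (u u' v : Fin n → ℝ) :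
    edgeForm e (u + u') v = edgeForm e u v + edgeForm e u' v := by
  simp only [edgeForm, Pi.add_apply, add_mul, mul_add, Finset.sum_add_distrib]

/-- Averaging with the swapped indices. Each unordered pair now contributes a rank one form, as
needed for the noise and the drift. -/
lemma edgeForm_eq_of_antisymm {e : Fin n → Fin n → ℝ} (he : ∀ i j, e j i = -e i j)
    (u v : Fin n → ℝ) :
    edgeForm e u v = (∑ i, ∑ j, e i j * ((u i + u j) * (v j - v i))) / 2 := by
  have h1 : edgeForm e u v = ∑ i, ∑ j, e i j * (u j * (v j - v i)) := by
    rw [edgeForm, Finset.sum_comm]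
    refine Finset.sum_congr rfl fun i _ => Finset.sum_congr rfl fun j _ => ?_
    rw [he]; ring
  have h2 : edgeForm e u v + edgeForm e u v = ∑ i, ∑ j, e i j * ((u i + u j) * (v j - v i)) := by
    nth_rewrite 2 [h1]
    simp only [edgeForm, ← Finset.sum_add_distrib]
    exact Finset.sum_congr rfl fun i _ => Finset.sum_congr rfl fun j _ => by ring
  linarith

lemma edgeForm_mul_of_reversible {e : Fin n → Fin n → ℝ} {p : Fin n → ℝ}
    (he : ∀ i j, p i * e i j = p j * e j i) (h : Fin n → ℝ) :
    edgeForm e (fun i => p i * h i) h = -((∑ i, ∑ j, p i * e i j * (h i - h j) ^ 2) / 2) := by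
  have h1 : edgeForm e (fun i => p i * h i) h = ∑ i, ∑ j, p i * e i j * (h j * (h i - h j)) := by
    rw [edgeForm, Finset.sum_comm]
    refine Finset.sum_congr rfl fun i _ => Finset.sum_congr rfl fun j _ => ?_
    rw [he i j]; ring
  have h2 : edgeForm e (fun i => p i * h i) h + edgeForm e (fun i => p i * h i) h =
      -∑ i, ∑ j, p i * e i j * (h i - h j) ^ 2 := by
    nth_rewrite 2 [h1]
    simp only [edgeForm, ← Finset.sum_add_distrib, ← Finset.sum_neg_distrib]
    exact Finset.sum_congr rfl fun i _ => Finset.sum_congr rfl fun j _ => by ring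
  linarith

/-- Detailed balance makes the summand antisymmetric in i and j: a reversible measure is stationary.
-/
lemma edgeForm_eq_zero_of_reversible {e : Fin n → Fin n → ℝ} {p : Fin n → ℝ}
    (he : ∀ i j, p i * e i j = p j * e j i) (v : Fin n → ℝ) : edgeForm e p v = 0 := by
  have h1 : edgeForm e p v = ∑ i, ∑ j, p i * e i j * (v i - v j) := by
    rw [edgeForm, Finset.sum_comm]
    refine Finset.sum_congr rfl fun i _ => Finset.sum_congr rfl fun j _ => ?_
    rw [he i j]; ring
  have h2 : edgeForm e p v + edgeForm e p v = 0 := by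
    nth_rewrite 2 [h1]
    simp only [edgeForm, ← Finset.sum_add_distrib]
    exact Finset.sum_eq_zero fun i _ => Finset.sum_eq_zero fun j _ => by ring
  linarith

lemma sum_sum_eq_two_mul_sum_lt {f : Fin n → Fin n → ℝ} (hf : ∀ i j, f j i = f i j)
    (h0 : ∀ i, f i i = 0) :
    ∑ i, ∑ j, f i j = 2 * ∑ i, ∑ j, if i < j then f i j else 0 := by
  have h1 : ∑ i, ∑ j, (if j < i then f i j else 0) = ∑ i, ∑ j, if i < j then f i j else 0 := by
    rw [Finset.sum_comm]
    exact Finset.sum_congr rfl fun i _ => Finset.sum_congr rfl fun j _ => by rw [hf]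
  have h2 : ∑ i, ∑ j, f i j = ∑ i, ∑ j, (if i < j then f i j else 0) +
      ∑ i, ∑ j, (if j < i then f i j else 0) := by
    simp only [← Finset.sum_add_distrib]
    refine Finset.sum_congr rfl fun i _ => Finset.sum_congr rfl fun j _ => ?_
    rcases lt_trichotomy i j with h | h | h
    · simp [h, h.le]
    · subst h; simp [h0]
    · simp [h, h.le]
  rw [h2, h1]; ring

lemma edgeForm_eq_sum_lt {e : Fin n → Fin n → ℝ} (he : ∀ i j, e j i = -e i j)
    (u v : Fin n → ℝ) :
    edgeForm e u v = ∑ i, ∑ j, if i < j then e i j * ((u i + u j) * (v j - v i)) else 0 := by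
  rw [edgeForm_eq_of_antisymm he, sum_sum_eq_two_mul_sum_lt]
  · ring
  · intro i j; rw [he]; ring
  · intro i; simp

end EdgeForm

/-! ### Degree bounds for sums over edges -/

section Graph

variable {n : ℕ}

open scoped Classical in
lemma sum_adjMatrix_row (H : SimpleGraph (Fin n)) (i : Fin n) :
    ∑ j, H.adjMatrix ℝ i j = H.degree i := by
  simp [SimpleGraph.adjMatrix_apply, ← SimpleGraph.card_neighborFinset_eq_degree,
    SimpleGraph.neighborFinset_eq_filter]

open scoped Classical in
lemma sum_adjMatrix_mul_sq_add_sq_le (H : SimpleGraph (Fin n)) (u : Fin n → ℝ) :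
    ∑ i, ∑ j, H.adjMatrix ℝ i j * (u i ^ 2 + u j ^ 2) ≤ 2 * dMax H * (u ⬝ᵥ u) := by
  have e1 : ∑ i, ∑ j, H.adjMatrix ℝ i j * u i ^ 2 ≤ dMax H * (u ⬝ᵥ u) := by
    rw [dotProduct, Finset.mul_sum]
    refine Finset.sum_le_sum fun i _ => ?_
    rw [← Finset.sum_mul, sum_adjMatrix_row, ← pow_two]
    refine mul_le_mul_of_nonneg_right ?_ (sq_nonneg _)
    exact_mod_cast H.degree_le_maxDegree i
  have e2 : ∑ i, ∑ j, H.adjMatrix ℝ i j * u j ^ 2 = ∑ i, ∑ j, H.adjMatrix ℝ i j * u i ^ 2 := by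
    rw [Finset.sum_comm]
    refine Finset.sum_congr rfl fun i _ => Finset.sum_congr rfl fun j _ => ?_
    rw [← H.isSymm_adjMatrix.apply i j]
  simp only [mul_add, Finset.sum_add_distrib]
  rw [e2]
  linarith

open scoped Classical in
lemma sum_adjMatrix_mul_add_sq_le (H : SimpleGraph (Fin n)) (u : Fin n → ℝ) :
    ∑ i, ∑ j, H.adjMatrix ℝ i j * (u i + u j) ^ 2 ≤ 4 * dMax H * (u ⬝ᵥ u) := by
  have h : ∑ i, ∑ j, H.adjMatrix ℝ i j * (u i + u j) ^ 2 ≤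
      2 * ∑ i, ∑ j, H.adjMatrix ℝ i j * (u i ^ 2 + u j ^ 2) := by
    simp only [Finset.mul_sum]
    refine Finset.sum_le_sum fun i _ => Finset.sum_le_sum fun j _ => ?_
    rw [SimpleGraph.adjMatrix_apply]
    split_ifs <;> nlinarith [sq_nonneg (u i - u j)]
  linarith [sum_adjMatrix_mul_sq_add_sq_le H u]

open scoped Classical in
lemma sum_adjMatrix_mul_sub_sq_le (H : SimpleGraph (Fin n)) (u : Fin n → ℝ) :
    ∑ i, ∑ j, H.adjMatrix ℝ i j * (u j - u i) ^ 2 ≤ 4 * dMax H * (u ⬝ᵥ u) := by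
  have h : ∑ i, ∑ j, H.adjMatrix ℝ i j * (u j - u i) ^ 2 ≤
      2 * ∑ i, ∑ j, H.adjMatrix ℝ i j * (u i ^ 2 + u j ^ 2) := by
    simp only [Finset.mul_sum]
    refine Finset.sum_le_sum fun i _ => Finset.sum_le_sum fun j _ => ?_
    rw [SimpleGraph.adjMatrix_apply]
    split_ifs <;> nlinarith [sq_nonneg (u i + u j)]
  linarith [sum_adjMatrix_mul_sq_add_sq_le H u]

open scoped Classical in
lemma abs_edgeForm_le (H : SimpleGraph (Fin n)) {e : Fin n → Fin n → ℝ}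
    (he : ∀ i j, e j i = -e i j) {m : ℝ} (hm : 0 ≤ m) (hb : ∀ i j, |e i j| ≤ m * H.adjMatrix ℝ i j)
    (u v : Fin n → ℝ) :
    |edgeForm e u v| ≤ 2 * m * dMax H * (√(u ⬝ᵥ u) * √(v ⬝ᵥ v)) := by
  have hA : ∀ i j, 0 ≤ H.adjMatrix ℝ i j := fun i j => by
    rw [SimpleGraph.adjMatrix_apply]; split_ifs <;> norm_num
  have hA2 : ∀ i j, H.adjMatrix ℝ i j * H.adjMatrix ℝ i j = H.adjMatrix ℝ i j := fun i j => by
    rw [SimpleGraph.adjMatrix_apply]; split_ifs <;> norm_num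
  set F := ∑ i, ∑ j, H.adjMatrix ℝ i j * (|u i + u j| * |v j - v i|) with hF
  have hle : |edgeForm e u v| ≤ m / 2 * F := by
    rw [edgeForm_eq_of_antisymm he, abs_div, abs_two, div_le_iff₀ two_pos]
    refine (Finset.abs_sum_le_sum_abs _ _).trans ?_
    rw [hF, mul_right_comm, div_mul_cancel₀ _ two_ne_zero, Finset.mul_sum]
    refine Finset.sum_le_sum fun i _ => (Finset.abs_sum_le_sum_abs _ _).trans ?_
    rw [Finset.mul_sum]
    refine Finset.sum_le_sum fun j _ => ?_
    rw [abs_mul, abs_mul, ← mul_assoc m]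
    exact mul_le_mul_of_nonneg_right (hb i j) (by positivity)
  have hF2 : F ≤ 4 * dMax H * (√(u ⬝ᵥ u) * √(v ⬝ᵥ v)) := by
    refine le_of_sq_le_sq ?_ (by positivity)
    -- Cauchy-Schwarz over ordered pairs; the 0-1 adjacency weight is idempotent, so both factors
    -- keep a copy.
    have hcs := Finset.sum_mul_sq_le_sq_mul_sq (univ : Finset (Fin n × Fin n))
      (fun p => H.adjMatrix ℝ p.1 p.2 * |u p.1 + u p.2|)
      (fun p => H.adjMatrix ℝ p.1 p.2 * |v p.2 - v p.1|)
    have hF' : F = ∑ i, ∑ j, H.adjMatrix ℝ i j * |u i + u j| * (H.adjMatrix ℝ i j * |v j - v i|) := by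
      refine Finset.sum_congr rfl fun i _ => Finset.sum_congr rfl fun j _ => ?_
      rw [mul_mul_mul_comm, hA2]
    simp only [Fintype.sum_prod_type, mul_pow, sq_abs] at hcs
    simp only [pow_two (H.adjMatrix ℝ _ _), hA2] at hcs
    rw [hF']
    refine hcs.trans ?_
    have huu : 0 ≤ u ⬝ᵥ u := by
      rw [dotProduct]; exact Finset.sum_nonneg fun i _ => mul_self_nonneg _
    have hvv : 0 ≤ v ⬝ᵥ v := by
      rw [dotProduct]; exact Finset.sum_nonneg fun i _ => mul_self_nonneg _
    rw [mul_pow, mul_pow (√_), Real.sq_sqrt huu, Real.sq_sqrt hvv]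
    calc _ ≤ (4 * dMax H * (u ⬝ᵥ u)) * (4 * dMax H * (v ⬝ᵥ v)) :=
          mul_le_mul (sum_adjMatrix_mul_add_sq_le H u) (sum_adjMatrix_mul_sub_sq_le H v)
            (Finset.sum_nonneg fun i _ => Finset.sum_nonneg fun j _ =>
              mul_nonneg (hA i j) (sq_nonneg _)) (by positivity)
      _ = _ := by ring
  calc _ ≤ m / 2 * F := hle
    _ ≤ m / 2 * (4 * dMax H * (√(u ⬝ᵥ u) * √(v ⬝ᵥ v))) := by gcongr
    _ = _ := by ring

/-- This makes the ratio of the number of edges to the maximum degree at least 1, so that the drift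
terms of the theorem dominate those of the proof. -/
lemma dMax_le_numEdges (H : SimpleGraph (Fin n)) (h : 0 < dMax H) : dMax H ≤ numEdges H := by
  classical
  have : Nonempty (Fin n) := by
    by_contra hn
    rw [not_nonempty_iff] at hn
    rw [dMax, SimpleGraph.maxDegree_of_subsingleton] at h
    exact lt_irrefl _ h
  obtain ⟨v, hv⟩ := H.exists_maximal_degree_vertex
  rw [dMax, numEdges]
  convert H.degree_le_card_edgeFinset (v := v)

lemma dMin_le_dMax (H : SimpleGraph (Fin n)) : dMin H ≤ dMax H := by
  classical
  exact H.minDegree_le_maxDegree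

end Graph

/-! ### Averaged win rates and the estimated transition matrix -/

section Neighborhoods

variable {n T L : ℕ} {G : Fin (T + 1) → SimpleGraph (Fin n)} {δ t d : ℝ}

lemma unionGraph_adj {i j : Fin n} :
    (unionGraph G δ t).Adj i j ↔ ∃ s ∈ nbhd T δ t, (G s).Adj i j := by
  simp [unionGraph, SimpleGraph.iSup_adj]

lemma mem_pairNbhd {i j : Fin n} {s : Fin (T + 1)} :
    s ∈ pairNbhd G δ t i j ↔ s ∈ nbhd T δ t ∧ (G s).Adj i j := by
  simp [pairNbhd]

lemma pairNbhd_comm (i j : Fin n) : pairNbhd G δ t i j = pairNbhd G δ t j i := by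
  ext s; simp only [mem_pairNbhd, SimpleGraph.adj_comm]

lemma pairNbhd_card_pos_iff {i j : Fin n} :
    0 < (pairNbhd G δ t i j).card ↔ (unionGraph G δ t).Adj i j := by
  rw [Finset.card_pos, unionGraph_adj]
  simp [Finset.Nonempty, mem_pairNbhd]

lemma pairNbhd_eq_empty {i j : Fin n} (h : ¬ (unionGraph G δ t).Adj i j) :
    pairNbhd G δ t i j = ∅ := by
  rw [← pairNbhd_card_pos_iff, not_lt, Nat.le_zero, Finset.card_eq_zero] at h
  exact h

lemma Nmin_le_card {i j : Fin n} (h : (unionGraph G δ t).Adj i j) :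
    Nmin G δ t ≤ (pairNbhd G δ t i j).card :=
  Nat.sInf_le ⟨i, j, h, rfl⟩

lemma Nmin_mem {i j : Fin n} (h : (unionGraph G δ t).Adj i j) : Nmin G δ t ∈ pairCounts G δ t :=
  Nat.sInf_mem ⟨_, i, j, h, rfl⟩

lemma Nmin_pos {i j : Fin n} (h : (unionGraph G δ t).Adj i j) : 0 < Nmin G δ t := by
  obtain ⟨i', j', h', he⟩ := Nmin_mem h
  rw [he]
  exact pairNbhd_card_pos_iff.2 h'

lemma Nmin_le_Nmax {i j : Fin n} (h : (unionGraph G δ t).Adj i j) :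
    Nmin G δ t ≤ Nmax G δ t := by
  refine le_csSup ⟨T + 1, ?_⟩ (Nmin_mem h)
  rintro k ⟨i', j', -, rfl⟩
  simpa using Finset.card_le_univ (pairNbhd G δ t i' j')

lemma avgWinRate_eq_zero {y : Fin (T + 1) → Fin n → Fin n → Fin L → ℝ} {i j : Fin n}
    (h : ¬ (unionGraph G δ t).Adj i j) : avgWinRate G δ t y i j = 0 := by
  rw [avgWinRate, pairNbhd_eq_empty h]; simp

lemma avgWinRate_sub (y z : Fin (T + 1) → Fin n → Fin n → Fin L → ℝ) (i j : Fin n) :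
    avgWinRate G δ t (fun s i j l => y s i j l - z s i j l) i j =
      avgWinRate G δ t y i j - avgWinRate G δ t z i j := by
  simp only [avgWinRate, winRate, Finset.sum_sub_distrib, mul_sub]

lemma avgWinRate_antisymm {y : Fin (T + 1) → Fin n → Fin n → Fin L → ℝ}
    (hy : ∀ s i j l, (G s).Adj i j → y s j i l = -y s i j l) (i j : Fin n) :
    avgWinRate G δ t y j i = -avgWinRate G δ t y i j := by
  rw [avgWinRate, avgWinRate, pairNbhd_comm j i, ← mul_neg, ← Finset.sum_neg_distrib]
  congr 1
  refine Finset.sum_congr rfl fun s hs => ?_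
  rw [winRate, winRate, ← mul_neg, ← Finset.sum_neg_distrib]
  congr 1
  exact Finset.sum_congr rfl fun l _ => hy s i j l (mem_pairNbhd.1 hs).2

lemma winRate_mem_Icc (hL : 1 ≤ L) {y : Fin (T + 1) → Fin n → Fin n → Fin L → ℝ}
    {s : Fin (T + 1)} {i j : Fin n} {a b : ℝ} (hy : ∀ l, y s i j l ∈ Set.Icc a b) :
    winRate y s i j ∈ Set.Icc a b := by
  have hL' : (0 : ℝ) < L := by exact_mod_cast hL
  rw [winRate, one_div, inv_mul_eq_div]
  constructor
  · rw [le_div_iff₀ hL']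
    calc a * L = ∑ l : Fin L, a := by simp [mul_comm]
      _ ≤ _ := Finset.sum_le_sum fun l _ => (hy l).1
  · rw [div_le_iff₀ hL']
    calc _ ≤ ∑ l : Fin L, b := Finset.sum_le_sum fun l _ => (hy l).2
      _ = _ := by simp [mul_comm]

lemma avgWinRate_mem_Icc (hL : 1 ≤ L) {y : Fin (T + 1) → Fin n → Fin n → Fin L → ℝ}
    {i j : Fin n} (h : (unionGraph G δ t).Adj i j) {a b : ℝ}
    (hy : ∀ s ∈ pairNbhd G δ t i j, ∀ l, y s i j l ∈ Set.Icc a b) :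
    avgWinRate G δ t y i j ∈ Set.Icc a b := by
  have hc : (0 : ℝ) < (pairNbhd G δ t i j).card := by exact_mod_cast pairNbhd_card_pos_iff.2 h
  rw [avgWinRate, one_div, inv_mul_eq_div]
  constructor
  · rw [le_div_iff₀ hc]
    calc a * (pairNbhd G δ t i j).card = ∑ s ∈ pairNbhd G δ t i j, a := by simp [mul_comm]
      _ ≤ _ := Finset.sum_le_sum fun s hs => (winRate_mem_Icc hL (hy s hs)).1
  · rw [div_le_iff₀ hc]
    calc _ ≤ ∑ s ∈ pairNbhd G δ t i j, b :=
          Finset.sum_le_sum fun s hs => (winRate_mem_Icc hL (hy s hs)).2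
      _ = _ := by simp [mul_comm]

/-- The diagonal entries compensate the row sums, and win rates vanish off the edges. Stationarity
thereby becomes the vanishing of an edge form. -/
lemma dotProduct_estMatrix_mulVec (y : Fin (T + 1) → Fin n → Fin n → Fin L → ℝ)
    (u v : Fin n → ℝ) :
    u ⬝ᵥ (estMatrix G δ t d y *ᵥ v) = u ⬝ᵥ v + edgeForm (avgWinRate G δ t y) u v / d := by
  classical
  have hrow : ∀ i, (estMatrix G δ t d y *ᵥ v) i =
      v i + (∑ j, avgWinRate G δ t y i j * (v j - v i)) / d := by
    intro i
    have h1 : ∀ j, estMatrix G δ t d y i j * v j =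
        (if i = j then v i - (∑ k, avgWinRate G δ t y i k) / d * v i else 0) +
          avgWinRate G δ t y i j * v j / d := by
      intro j
      rw [estMatrix, of_apply]
      split_ifs with hij hadj
      · subst hij
        rw [avgWinRate_eq_zero (SimpleGraph.irrefl _), Finset.sum_filter]
        have : ∀ k, (if k ≠ i then avgWinRate G δ t y i k else 0) = avgWinRate G δ t y i k := by
          intro k
          split_ifs with hk
          · rfl
          · rw [not_not.1 hk, avgWinRate_eq_zero (SimpleGraph.irrefl _)]
        simp_rw [this]
        ring
      · ring
      · rw [avgWinRate_eq_zero hadj]; ring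
    rw [mulVec, dotProduct]
    simp_rw [h1]
    rw [Finset.sum_add_distrib, Finset.sum_ite_eq]
    simp only [Finset.mem_univ, if_true, mul_sub, Finset.sum_sub_distrib, ← Finset.sum_mul,
      ← Finset.sum_div]
    ring
  rw [dotProduct]
  simp_rw [hrow, mul_add]
  rw [Finset.sum_add_distrib, edgeForm, Finset.sum_div]
  congr 1
  refine Finset.sum_congr rfl fun i _ => ?_
  rw [mul_div_assoc', Finset.mul_sum]
  congr 1
  exact Finset.sum_congr rfl fun j _ => by ring

lemma estMatrix_row_sum (y : Fin (T + 1) → Fin n → Fin n → Fin L → ℝ) (i : Fin n) :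
    ∑ j, estMatrix G δ t d y i j = 1 := by
  have h := dotProduct_estMatrix_mulVec (G := G) (δ := δ) (t := t) (d := d) y (Pi.single i 1)
    (fun _ => 1)
  rw [single_one_dotProduct, single_one_dotProduct] at h
  simpa [edgeForm, mulVec, dotProduct] using h

lemma estMatrix_nonneg (hL : 1 ≤ L) {y : Fin (T + 1) → Fin n → Fin n → Fin L → ℝ}
    (hy : ∀ s i j l, (G s).Adj i j → y s i j l ∈ Set.Icc (0 : ℝ) 1) (hd0 : 0 < d)
    (hd : (dMax (unionGraph G δ t) : ℝ) ≤ d) (i j : Fin n) : 0 ≤ estMatrix G δ t d y i j := by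
  classical
  have ha : ∀ {i j}, (unionGraph G δ t).Adj i j → avgWinRate G δ t y i j ∈ Set.Icc (0 : ℝ) 1 :=
    fun h => avgWinRate_mem_Icc hL h fun s hs l => hy s _ _ l (mem_pairNbhd.1 hs).2
  rw [estMatrix, of_apply]
  split_ifs with hij hadj
  · have h1 : ∑ k ∈ univ.filter (fun k => k ≠ i), avgWinRate G δ t y i k ≤ d := by
      calc _ ≤ ∑ k ∈ univ.filter (fun k => k ≠ i), (unionGraph G δ t).adjMatrix ℝ i k := by
            refine Finset.sum_le_sum fun k _ => ?_
            rw [SimpleGraph.adjMatrix_apply]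
            split_ifs with h
            · exact (ha h).2
            · exact (avgWinRate_eq_zero h).le
        _ ≤ ∑ k, (unionGraph G δ t).adjMatrix ℝ i k := by
            refine Finset.sum_le_sum_of_subset_of_nonneg (Finset.filter_subset _ _) fun k _ _ => ?_
            rw [SimpleGraph.adjMatrix_apply]; split_ifs <;> norm_num
        _ ≤ dMax (unionGraph G δ t) := by
            rw [sum_adjMatrix_row]
            exact_mod_cast (unionGraph G δ t).degree_le_maxDegree i
        _ ≤ d := hd
    rw [one_div, inv_mul_eq_div, sub_nonneg, div_le_one hd0]
    exact h1
  · exact div_nonneg (ha hadj).1 hd0.le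
  · exact le_rfl

end Neighborhoods

/-! ### Sampling noise as a sum over independent comparisons -/

section Noise

variable {n T L : ℕ} {G : Fin (T + 1) → SimpleGraph (Fin n)} {δ t : ℝ}

/-- The indices of the observed comparisons. -/
abbrev SampleIndex (L : ℕ) (G : Fin (T + 1) → SimpleGraph (Fin n)) : Type :=
  {k : Fin (T + 1) × Fin n × Fin n × Fin L // k.2.1 < k.2.2.1 ∧ (G k.1).Adj k.2.1 k.2.2.1}

instance sampleIndexFintype : Fintype (SampleIndex L G) := Fintype.ofFinite _

open scoped Classical in
/-- The weight of a comparison in the average of its pair. -/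
def sampleWeight (G : Fin (T + 1) → SimpleGraph (Fin n)) (δ t : ℝ) (k : SampleIndex L G) : ℝ :=
  if k.1.1 ∈ nbhd T δ t then
    ((pairNbhd G δ t k.1.2.1 k.1.2.2.1).card * L : ℝ)⁻¹ else 0

open scoped Classical in
lemma sum_sampleIndex (F : Fin (T + 1) → Fin n → Fin n → Fin L → ℝ) :
    ∑ k : SampleIndex L G, (if k.1.1 ∈ nbhd T δ t then F k.1.1 k.1.2.1 k.1.2.2.1 k.1.2.2.2 else 0) =
      ∑ i, ∑ j, if i < j then ∑ s ∈ pairNbhd G δ t i j, ∑ l, F s i j l else 0 := by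
  rw [← Finset.sum_subtype (univ.filter fun k : Fin (T + 1) × Fin n × Fin n × Fin L =>
    k.2.1 < k.2.2.1 ∧ (G k.1).Adj k.2.1 k.2.2.1) (by simp)
    (fun k => if k.1 ∈ nbhd T δ t then F k.1 k.2.1 k.2.2.1 k.2.2.2 else 0), Finset.sum_filter]
  simp only [Fintype.sum_prod_type]
  rw [Finset.sum_comm]
  refine Finset.sum_congr rfl fun i _ => ?_
  rw [Finset.sum_comm]
  refine Finset.sum_congr rfl fun j _ => ?_
  by_cases hij : i < j
  · simp only [hij, true_and, if_true, pairNbhd, nbhd, Finset.sum_filter, Finset.filter_filter,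
      Finset.mem_filter, Finset.mem_univ]
    refine Finset.sum_congr rfl fun s _ => ?_
    by_cases h1 : (G s).Adj i j <;> by_cases h2 : |t - gridTime T s| ≤ δ / T <;> simp [h1, h2]
  · simp [hij]

open scoped Classical in
-- A pair compared at N times has NL comparisons of squared weight (NL)^(-2), in total 1/(NL). The
-- factor 2 appears because the adjacency matrix counts each pair twice.
lemma sum_sampleWeight_sq_mul_le (hL : 1 ≤ L) {f : Fin n → Fin n → ℝ} (hf : ∀ i j, f j i = f i j)
    (hf0 : ∀ i j, 0 ≤ f i j) :
    ∑ k : SampleIndex L G, sampleWeight G δ t k ^ 2 * f k.1.2.1 k.1.2.2.1 ≤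
      (∑ i, ∑ j, (unionGraph G δ t).adjMatrix ℝ i j * f i j) / (2 * (Nmin G δ t * L)) := by
  have hL' : (0 : ℝ) < L := by exact_mod_cast hL
  have h1 : ∀ k : SampleIndex L G, sampleWeight G δ t k ^ 2 * f k.1.2.1 k.1.2.2.1 =
      if k.1.1 ∈ nbhd T δ t then ((pairNbhd G δ t k.1.2.1 k.1.2.2.1).card * L : ℝ)⁻¹ ^ 2 *
        f k.1.2.1 k.1.2.2.1 else 0 := by
    intro k; rw [sampleWeight]; split_ifs <;> simp
  simp_rw [h1]
  rw [sum_sampleIndex (fun _ i j _ => ((pairNbhd G δ t i j).card * L : ℝ)⁻¹ ^ 2 * f i j),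
    sum_sum_eq_two_mul_sum_lt (f := fun i j => (unionGraph G δ t).adjMatrix ℝ i j * f i j)
      (fun i j => by rw [hf, (unionGraph G δ t).isSymm_adjMatrix.apply])
      (fun i => by simp), mul_div_mul_left _ _ two_ne_zero, Finset.sum_div]
  refine Finset.sum_le_sum fun i _ => ?_
  rw [Finset.sum_div]
  refine Finset.sum_le_sum fun j _ => ?_
  split_ifs with hij
  · simp only [Finset.sum_const, Finset.card_univ, Fintype.card_fin, nsmul_eq_mul]
    by_cases h : (unionGraph G δ t).Adj i j
    · have hN : (0 : ℝ) < (pairNbhd G δ t i j).card := by exact_mod_cast pairNbhd_card_pos_iff.2 h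
      have hm : (0 : ℝ) < Nmin G δ t := by exact_mod_cast Nmin_pos h
      have hmN : (Nmin G δ t : ℝ) ≤ (pairNbhd G δ t i j).card := by exact_mod_cast Nmin_le_card h
      rw [SimpleGraph.adjMatrix_apply, if_pos h, one_mul]
      calc _ = f i j / ((pairNbhd G δ t i j).card * L) := by field_simp
        _ ≤ _ := by
          have := hf0 i j
          gcongr
    · rw [pairNbhd_eq_empty h, SimpleGraph.adjMatrix_apply, if_neg h]; simp
  · simp

lemma edgeForm_avgWinRate_eq_sum {z : Fin (T + 1) → Fin n → Fin n → Fin L → ℝ}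
    (hz : ∀ s i j l, (G s).Adj i j → z s j i l = -z s i j l) (u v : Fin n → ℝ) :
    edgeForm (avgWinRate G δ t z) u v =
      ∑ k : SampleIndex L G, z k.1.1 k.1.2.1 k.1.2.2.1 k.1.2.2.2 * (sampleWeight G δ t k *
        ((u k.1.2.1 + u k.1.2.2.1) * (v k.1.2.2.1 - v k.1.2.1))) := by
  classical
  have h1 : ∀ k : SampleIndex L G, z k.1.1 k.1.2.1 k.1.2.2.1 k.1.2.2.2 * (sampleWeight G δ t k *
        ((u k.1.2.1 + u k.1.2.2.1) * (v k.1.2.2.1 - v k.1.2.1))) =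
      if k.1.1 ∈ nbhd T δ t then z k.1.1 k.1.2.1 k.1.2.2.1 k.1.2.2.2 *
        (((pairNbhd G δ t k.1.2.1 k.1.2.2.1).card * L : ℝ)⁻¹ *
        ((u k.1.2.1 + u k.1.2.2.1) * (v k.1.2.2.1 - v k.1.2.1))) else 0 := by
    intro k; rw [sampleWeight]; split_ifs <;> simp
  simp_rw [h1]
  rw [sum_sampleIndex (fun s i j l => z s i j l * (((pairNbhd G δ t i j).card * L : ℝ)⁻¹ *
        ((u i + u j) * (v j - v i)))), edgeForm_eq_sum_lt (avgWinRate_antisymm hz)]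
  refine Finset.sum_congr rfl fun i _ => Finset.sum_congr rfl fun j _ => ?_
  split_ifs with hij
  · simp only [avgWinRate, winRate, ← Finset.sum_mul, ← Finset.mul_sum]
    rw [mul_inv]
    ring
  · rfl

/-- The symmetric dilation of the rank one matrix `p qᵀ`. -/
def rankOneDilation (p q : Fin n → ℝ) : Matrix (Fin n ⊕ Fin n) (Fin n ⊕ Fin n) ℝ :=
  fromBlocks 0 (vecMulVec p q) (vecMulVec q p) 0

lemma isSymm_rankOneDilation (p q : Fin n → ℝ) : (rankOneDilation p q).IsSymm := by
  rw [IsSymm, rankOneDilation, fromBlocks_transpose, transpose_vecMulVec, transpose_vecMulVec]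
  simp

lemma rankOneDilation_mulVec (p q : Fin n → ℝ) (w : Fin n ⊕ Fin n → ℝ) :
    rankOneDilation p q *ᵥ w =
      Sum.elim ((q ⬝ᵥ (w ∘ Sum.inr)) • p) ((p ⬝ᵥ (w ∘ Sum.inl)) • q) := by
  rw [rankOneDilation, fromBlocks_mulVec, zero_mulVec, zero_mulVec, zero_add, add_zero,
    vecMulVec_mulVec, vecMulVec_mulVec]
  simp

/-- The symmetric matrix multiplying a centered comparison in the noise. -/
def sampleMatrix (G : Fin (T + 1) → SimpleGraph (Fin n)) (δ t : ℝ) (k : SampleIndex L G) :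
    Matrix (Fin n ⊕ Fin n) (Fin n ⊕ Fin n) ℝ :=
  sampleWeight G δ t k • rankOneDilation
    (Pi.single k.1.2.1 1 + Pi.single k.1.2.2.1 1) (Pi.single k.1.2.2.1 1 - Pi.single k.1.2.1 1)

lemma isSymm_sampleMatrix (k : SampleIndex L G) : (sampleMatrix G δ t k).IsSymm := by
  rw [sampleMatrix, IsSymm, transpose_smul, (isSymm_rankOneDilation _ _).eq]

/-- The noise form is not symmetric while the trace method needs symmetric matrices; an off-diagonal
block of the dilation recovers the form. -/
lemma dotProduct_sampleMatrix_mulVec (k : SampleIndex L G) (u v : Fin n → ℝ) :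
    Sum.elim u 0 ⬝ᵥ (sampleMatrix G δ t k *ᵥ Sum.elim 0 v) =
      sampleWeight G δ t k * ((u k.1.2.1 + u k.1.2.2.1) * (v k.1.2.2.1 - v k.1.2.1)) := by
  rw [sampleMatrix, smul_mulVec, rankOneDilation_mulVec, dotProduct_smul, sumElim_dotProduct_sumElim]
  simp only [sub_dotProduct, dotProduct_add, dotProduct_smul, dotProduct_single_one, single_one_dotProduct,
    Sum.elim_comp_inl, Sum.elim_comp_inr, zero_dotProduct, smul_eq_mul]
  ring

lemma sampleMatrix_mulVec_dotProduct_self (k : SampleIndex L G) (w : Fin n ⊕ Fin n → ℝ) :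
    (sampleMatrix G δ t k *ᵥ w) ⬝ᵥ (sampleMatrix G δ t k *ᵥ w) =
      sampleWeight G δ t k ^ 2 * (2 * ((w (Sum.inl k.1.2.1) + w (Sum.inl k.1.2.2.1)) ^ 2 +
        (w (Sum.inr k.1.2.2.1) - w (Sum.inr k.1.2.1)) ^ 2)) := by
  have hne : k.1.2.1 ≠ k.1.2.2.1 := k.2.1.ne
  have hp : ((Pi.single k.1.2.1 1 + Pi.single k.1.2.2.1 1 : Fin n → ℝ)) ⬝ᵥ
      (Pi.single k.1.2.1 1 + Pi.single k.1.2.2.1 1) = 2 := by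
    simp [hne, hne.symm]; norm_num
  have hq : ((Pi.single k.1.2.2.1 1 - Pi.single k.1.2.1 1 : Fin n → ℝ)) ⬝ᵥ
      (Pi.single k.1.2.2.1 1 - Pi.single k.1.2.1 1) = 2 := by
    simp [hne, hne.symm]; norm_num
  rw [sampleMatrix, smul_mulVec, rankOneDilation_mulVec, dotProduct_smul, smul_dotProduct,
    sumElim_dotProduct_sumElim, smul_dotProduct, smul_dotProduct, dotProduct_smul, dotProduct_smul,
    hp, hq]
  simp only [add_dotProduct, sub_dotProduct, single_one_dotProduct, Function.comp, smul_eq_mul]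
  ring

lemma sum_sampleMatrix_mulVec_sq_le (hL : 1 ≤ L) (w : Fin n ⊕ Fin n → ℝ) :
    ∑ k : SampleIndex L G, (sampleMatrix G δ t k *ᵥ w) ⬝ᵥ (sampleMatrix G δ t k *ᵥ w) ≤
      4 * dMax (unionGraph G δ t) / (Nmin G δ t * L) * (w ⬝ᵥ w) := by
  classical
  simp_rw [sampleMatrix_mulVec_dotProduct_self]
  refine (sum_sampleWeight_sq_mul_le hL (f := fun i j => 2 * ((w (Sum.inl i) + w (Sum.inl j)) ^ 2 +
        (w (Sum.inr j) - w (Sum.inr i)) ^ 2)) (fun i j => by ring)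
        (fun i j => by positivity)).trans ?_
  have h1 := sum_adjMatrix_mul_add_sq_le (unionGraph G δ t) (w ∘ Sum.inl)
  have h2 := sum_adjMatrix_mul_sub_sq_le (unionGraph G δ t) (w ∘ Sum.inr)
  have hw : w ⬝ᵥ w = (w ∘ Sum.inl) ⬝ᵥ (w ∘ Sum.inl) + (w ∘ Sum.inr) ⬝ᵥ (w ∘ Sum.inr) := by
    simp [dotProduct, Fintype.sum_sum_type]
  have h3 : ∑ i, ∑ j, (unionGraph G δ t).adjMatrix ℝ i j * (2 * ((w (Sum.inl i) + w (Sum.inl j)) ^ 2 +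
        (w (Sum.inr j) - w (Sum.inr i)) ^ 2)) ≤ 2 * (4 * dMax (unionGraph G δ t) * (w ⬝ᵥ w)) := by
    rw [hw, mul_add, mul_add]
    refine le_trans (le_of_eq ?_) (add_le_add (mul_le_mul_of_nonneg_left h1 zero_le_two)
      (mul_le_mul_of_nonneg_left h2 zero_le_two))
    simp only [Finset.mul_sum, ← Finset.sum_add_distrib, Function.comp]
    exact Finset.sum_congr rfl fun i _ => Finset.sum_congr rfl fun j _ => by ring
  calc _ ≤ 2 * (4 * dMax (unionGraph G δ t) * (w ⬝ᵥ w)) / (2 * (Nmin G δ t * L)) := by gcongr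
    _ = _ := by rw [mul_div_mul_left _ _ two_ne_zero]; ring

variable {Ω : Type*} [MeasurableSpace Ω] {μ : Measure Ω} [IsProbabilityMeasure μ]
  {w : ℝ → Fin n → ℝ} {Y : Fin (T + 1) → Fin n → Fin n → Fin L → Ω → ℝ}

/-- The centered comparisons. -/
def centeredOutcome (w : ℝ → Fin n → ℝ) (Y : Fin (T + 1) → Fin n → Fin n → Fin L → Ω → ℝ) (ω : Ω)
    (s : Fin (T + 1)) (i j : Fin n) (l : Fin L) : ℝ :=
  Y s i j l ω - btlProb (w (gridTime T s)) i j

lemma IsBTLSample.integral_eq (h : IsBTLSample μ w G Y) {s : Fin (T + 1)} {i j : Fin n}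
    (hadj : (G s).Adj i j) (l : Fin L) :
    ∫ ω, Y s i j l ω ∂μ = btlProb (w (gridTime T s)) i j := by
  rw [← h.win_prob s i j l hadj]
  have hind : Y s i j l = Set.indicator {ω | Y s i j l ω = 1} 1 := by
    ext ω
    rcases h.binary s i j l ω hadj with h' | h' <;> simp [Set.indicator, h']
  have hmeas : MeasurableSet {ω | Y s i j l ω = 1} :=
    h.measurable s i j l hadj (measurableSet_singleton 1)
  calc ∫ ω, Y s i j l ω ∂μ = ∫ ω, Set.indicator {ω | Y s i j l ω = 1} 1 ω ∂μ := by rw [← hind]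
    _ = _ := integral_indicator_one hmeas

lemma IsBTLSample.centeredOutcome_antisymm (h : IsBTLSample μ w G Y) (ω : Ω) (s : Fin (T + 1))
    (i j : Fin n) (l : Fin L) (hadj : (G s).Adj i j) :
    centeredOutcome w Y ω s j i l = -centeredOutcome w Y ω s i j l := by
  have h1 : btlProb (w (gridTime T s)) j i = 1 - btlProb (w (gridTime T s)) i j := by
    rw [← h.integral_eq hadj l, ← h.integral_eq hadj.symm l]
    simp_rw [fun ω => h.reverse s i j l ω hadj]
    rw [integral_sub (integrable_const _)]
    · simp
    · exact Integrable.of_bound (h.measurable s i j l hadj).aestronglyMeasurable 1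
        (ae_of_all _ fun ω => by rcases h.binary s i j l ω hadj with h' | h' <;> simp [h'])
  rw [centeredOutcome, centeredOutcome, h.reverse s i j l ω hadj, h1]
  ring

/-- Matrix concentration for the dilation, whose dimension 2n is the prefactor, followed by
Cauchy-Schwarz. -/
lemma IsBTLSample.measure_noise_opNorm (h : IsBTLSample μ w G Y) (hL : 1 ≤ L)
    (hmax : 0 < dMax (unionGraph G δ t)) (hmin : 0 < Nmin G δ t) {m : ℕ} (hm : m ≠ 0) :
    μ.real {ω | ¬ ∀ u v : Fin n → ℝ,
        edgeForm (avgWinRate G δ t (centeredOutcome w Y ω)) u v ^ 2 ≤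
          Real.exp 11 * (2 * m * (4 * dMax (unionGraph G δ t) / (Nmin G δ t * L))) *
            ((u ⬝ᵥ u) * (v ⬝ᵥ v))} ≤ 2 * n * Real.exp (-11 * m) := by
  classical
  have hL' : (0 : ℝ) < L := by exact_mod_cast hL
  have hmax' : (0 : ℝ) < dMax (unionGraph G δ t) := by exact_mod_cast hmax
  have hmin' : (0 : ℝ) < Nmin G δ t := by exact_mod_cast hmin
  set y : SampleIndex L G → Ω → ℝ := fun k => Y k.1.1 k.1.2.1 k.1.2.2.1 k.1.2.2.2 with hy
  have key := measure_centeredSeries_opNorm (μ := μ) (y := y) (S := sampleMatrix G δ t)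
    (V := 4 * dMax (unionGraph G δ t) / (Nmin G δ t * L))
    (fun k => h.measurable _ _ _ _ k.2.2) (fun k ω => h.binary _ _ _ _ ω k.2.2) h.indep
    isSymm_sampleMatrix (by positivity) (sum_sampleMatrix_mulVec_sq_le hL) hm
  refine le_trans (measureReal_mono ?_) (key.trans (le_of_eq ?_))
  · intro ω hω hall
    refine hω fun u v => ?_
    have hform : edgeForm (avgWinRate G δ t (centeredOutcome w Y ω)) u v =
        Sum.elim u 0 ⬝ᵥ (centeredSeries μ y (sampleMatrix G δ t) (fun k => y k ω) *ᵥ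
          Sum.elim 0 v) := by
      rw [edgeForm_avgWinRate_eq_sum (h.centeredOutcome_antisymm ω), centeredSeries, sum_mulVec,
        dotProduct_sum]
      refine Finset.sum_congr rfl fun k _ => ?_
      rw [smul_mulVec, dotProduct_smul, dotProduct_sampleMatrix_mulVec, smul_eq_mul,
        centeredOutcome, hy, h.integral_eq k.2.2]
    have hcs := Finset.sum_mul_sq_le_sq_mul_sq univ (Sum.elim u 0 : Fin n ⊕ Fin n → ℝ)
      (centeredSeries μ y (sampleMatrix G δ t) (fun k => y k ω) *ᵥ Sum.elim 0 v)
    have h2 := hall (Sum.elim 0 v)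
    rw [sumElim_dotProduct_sumElim] at h2
    rw [hform]
    have hu : ∑ i, (Sum.elim u 0 : Fin n ⊕ Fin n → ℝ) i ^ 2 = u ⬝ᵥ u := by
      simp [Fintype.sum_sum_type, dotProduct, pow_two]
    have huu : 0 ≤ u ⬝ᵥ u := by
      rw [dotProduct]; exact Finset.sum_nonneg fun i _ => mul_self_nonneg _
    rw [hu] at hcs
    refine hcs.trans ?_
    simp only [dotProduct_zero, zero_add] at h2
    calc _ ≤ (u ⬝ᵥ u) * (Real.exp 11 * (2 * m * (4 * dMax (unionGraph G δ t) / (Nmin G δ t * L))) *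
            (v ⬝ᵥ v)) := by
          refine mul_le_mul_of_nonneg_left (le_trans (le_of_eq ?_) h2) huu
          rw [dotProduct]
          simp only [pow_two]
      _ = _ := by ring
  · simp; ring

/-- With the left argument fixed, the noise is a random vector in ℝⁿ, and the vector bound avoids
the logarithm. The constant 8 is 4 · 4 / 2, from (p_i + p_j)² ≤ 4b², the Laplacian bound and the
double counting of edges. -/
lemma IsBTLSample.measure_noise_vector (h : IsBTLSample μ w G Y) (hL : 1 ≤ L)
    (hmax : 0 < dMax (unionGraph G δ t)) (hmin : 0 < Nmin G δ t) {p : Fin n → ℝ} {b : ℝ}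
    (hb : 0 < b) (hp : ∀ i, 0 ≤ p i ∧ p i ≤ b) :
    μ.real {ω | ¬ ∀ v : Fin n → ℝ,
        edgeForm (avgWinRate G δ t (centeredOutcome w Y ω)) p v ^ 2 ≤
          11 * n * (8 * b ^ 2 * dMax (unionGraph G δ t) / (Nmin G δ t * L)) * (v ⬝ᵥ v)} ≤
      Real.exp (-10 * n) := by
  classical
  have hL' : (0 : ℝ) < L := by exact_mod_cast hL
  have hmax' : (0 : ℝ) < dMax (unionGraph G δ t) := by exact_mod_cast hmax
  have hmin' : (0 : ℝ) < Nmin G δ t := by exact_mod_cast hmin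
  set y : SampleIndex L G → Ω → ℝ := fun k => Y k.1.1 k.1.2.1 k.1.2.2.1 k.1.2.2.2 with hy
  set a : SampleIndex L G → Fin n → ℝ := fun k =>
    (sampleWeight G δ t k * (p k.1.2.1 + p k.1.2.2.1)) •
      (Pi.single k.1.2.2.1 1 - Pi.single k.1.2.1 1) with ha
  have hga : ∀ k (g : Fin n → ℝ), g ⬝ᵥ a k =
      sampleWeight G δ t k * (p k.1.2.1 + p k.1.2.2.1) * (g k.1.2.2.1 - g k.1.2.1) := by
    intro k g
    simp [ha, dotProduct_smul, dotProduct_sub]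
  have hsq : ∀ g : Fin n → ℝ, ∑ k, (g ⬝ᵥ a k) ^ 2 ≤
      8 * b ^ 2 * dMax (unionGraph G δ t) / (Nmin G δ t * L) * (g ⬝ᵥ g) := by
    intro g
    calc ∑ k, (g ⬝ᵥ a k) ^ 2
        ≤ ∑ k : SampleIndex L G, sampleWeight G δ t k ^ 2 *
            (4 * b ^ 2 * (g k.1.2.2.1 - g k.1.2.1) ^ 2) := by
          refine Finset.sum_le_sum fun k _ => ?_
          rw [hga, mul_pow, mul_pow, mul_assoc]
          have h1 := hp k.1.2.1
          have h2 := hp k.1.2.2.1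
          have h3 : (p k.1.2.1 + p k.1.2.2.1) ^ 2 ≤ 4 * b ^ 2 := by nlinarith
          gcongr
      _ ≤ (∑ i, ∑ j, (unionGraph G δ t).adjMatrix ℝ i j * (4 * b ^ 2 * (g j - g i) ^ 2)) /
            (2 * (Nmin G δ t * L)) :=
          sum_sampleWeight_sq_mul_le hL (f := fun i j => 4 * b ^ 2 * (g j - g i) ^ 2)
            (fun i j => by ring) (fun i j => by positivity)
      _ = 4 * b ^ 2 * (∑ i, ∑ j, (unionGraph G δ t).adjMatrix ℝ i j * (g j - g i) ^ 2) /
            (2 * (Nmin G δ t * L)) := by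
          congr 1
          simp only [Finset.mul_sum]
          exact Finset.sum_congr rfl fun i _ => Finset.sum_congr rfl fun j _ => by ring
      _ ≤ 4 * b ^ 2 * (4 * dMax (unionGraph G δ t) * (g ⬝ᵥ g)) / (2 * (Nmin G δ t * L)) := by
          gcongr
          exact sum_adjMatrix_mul_sub_sq_le _ g
      _ = _ := by field_simp; ring
  set x : Ω → Fin n → ℝ := fun ω => ∑ k, (y k ω - ∫ ω', y k ω' ∂μ) • a k with hx
  have key := measure_centered_vector_norm (μ := μ) (y := y) (a := a)
    (τ := 8 * b ^ 2 * dMax (unionGraph G δ t) / (Nmin G δ t * L)) (v := x)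
    (fun k => h.measurable _ _ _ _ k.2.2) (fun k ω => h.binary _ _ _ _ ω k.2.2) h.indep
    (by positivity) hsq (fun _ => rfl)
  rw [Fintype.card_fin] at key
  refine le_trans (measureReal_mono ?_) key
  intro ω hω
  by_contra hlt
  refine hω fun v => ?_
  have hform : edgeForm (avgWinRate G δ t (centeredOutcome w Y ω)) p v = x ω ⬝ᵥ v := by
    rw [edgeForm_avgWinRate_eq_sum (h.centeredOutcome_antisymm ω), dotProduct_comm, hx,
      dotProduct_sum]
    refine Finset.sum_congr rfl fun k _ => ?_
    rw [dotProduct_smul, hga, smul_eq_mul, centeredOutcome, hy, h.integral_eq k.2.2]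
    ring
  have hcs := Finset.sum_mul_sq_le_sq_mul_sq univ (x ω) v
  have hxx : ∑ i, x ω i ^ 2 = x ω ⬝ᵥ x ω := by simp [dotProduct, pow_two]
  have hvv : ∑ i, v i ^ 2 = v ⬝ᵥ v := by simp [dotProduct, pow_two]
  rw [hxx, hvv] at hcs
  rw [hform]
  refine hcs.trans (mul_le_mul_of_nonneg_right (not_le.1 hlt).le ?_)
  rw [← hvv]; positivity

end Noise

/-! ### Absorbing the perturbation, and detailed balance of the BTL weights -/

section Deterministic

variable {n : ℕ}

lemma l2norm_eq (x : Fin n → ℝ) : l2norm x = √(x ⬝ᵥ x) := by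
  rw [l2norm, EuclideanSpace.norm_eq]
  congr 1
  rw [dotProduct]
  exact Finset.sum_congr rfl fun i _ => by simp [pow_two]

lemma dotProduct_self_nonneg_real (x : Fin n → ℝ) : 0 ≤ x ⬝ᵥ x := by
  rw [dotProduct]; exact Finset.sum_nonneg fun i _ => mul_self_nonneg _

/-- A Poincaré inequality turns a bound on a Dirichlet form into a bound on the Euclidean norm of
a signed measure `x` of total mass zero with density `h` with respect to `p`. -/
lemma norm_le_of_dirichlet_le {p h x : Fin n → ℝ} {pm b g α η c E : ℝ} (hb : 1 ≤ b) (hpm : 0 < pm)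
    (hp : ∀ i, pm ≤ p i ∧ p i ≤ b * pm) (hx : ∀ i, x i = p i * h i) (hsum : ∑ i, x i = 0)
    (hg : 0 < g) (hE : pm / 2 * g * ∑ i, (h i - c) ^ 2 ≤ E)
    (hE' : E ≤ α * (√(x ⬝ᵥ x) * √(h ⬝ᵥ h)) + η * √(h ⬝ᵥ h)) (hα : α ≤ g / (4 * (√b * b)))
    (hη : 0 ≤ η) : √(x ⬝ᵥ x) ≤ 4 * (√b * b) / g * η := by
  have hb0 : 0 < b := by linarith
  set q := ∑ i, p i * h i ^ 2 with hq
  have hp0 : ∀ i, 0 ≤ p i := fun i => hpm.le.trans (hp i).1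
  have hq0 : 0 ≤ q := Finset.sum_nonneg fun i _ => mul_nonneg (hp0 i) (sq_nonneg _)
  -- The density h has p-mean zero, so centering at any c only increases its weighted square sum;
  -- the unknown c disappears.
  have h1 : q ≤ b * pm * ∑ i, (h i - c) ^ 2 := by
    have e : ∑ i, p i * (h i - c) ^ 2 = q + (∑ i, p i) * c ^ 2 := by
      have : ∑ i, p i * (h i - c) ^ 2 = q - 2 * c * (∑ i, x i) + (∑ i, p i) * c ^ 2 := by
        rw [hq, Finset.mul_sum, Finset.sum_mul, ← Finset.sum_sub_distrib, ← Finset.sum_add_distrib]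
        exact Finset.sum_congr rfl fun i _ => by rw [hx]; ring
      rw [this, hsum]; ring
    calc q ≤ ∑ i, p i * (h i - c) ^ 2 := by
          rw [e]
          have : 0 ≤ (∑ i, p i) * c ^ 2 :=
            mul_nonneg (Finset.sum_nonneg fun i _ => hp0 i) (sq_nonneg _)
          linarith
      _ ≤ _ := by
          rw [Finset.mul_sum]
          exact Finset.sum_le_sum fun i _ => mul_le_mul_of_nonneg_right (hp i).2 (sq_nonneg _)
  have hXq : x ⬝ᵥ x ≤ b * pm * q := by
    rw [dotProduct, hq, Finset.mul_sum]
    refine Finset.sum_le_sum fun i _ => ?_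
    rw [hx]
    have := mul_le_mul_of_nonneg_right (hp i).2 (mul_nonneg (hp0 i) (sq_nonneg (h i)))
    linarith
  have hHq : h ⬝ᵥ h ≤ q / pm := by
    rw [le_div_iff₀ hpm, dotProduct, hq, Finset.sum_mul]
    refine Finset.sum_le_sum fun i _ => ?_
    have := mul_le_mul_of_nonneg_right (hp i).1 (sq_nonneg (h i))
    linarith
  set s := √pm
  have hs : 0 < s := Real.sqrt_pos.2 hpm
  set Q := √q
  have hQ0 : 0 ≤ Q := Real.sqrt_nonneg _
  have hQq : q = Q * Q := (Real.mul_self_sqrt hq0).symm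
  set r := √b
  have hr : 0 < r := Real.sqrt_pos.2 hb0
  have hX : √(x ⬝ᵥ x) ≤ r * s * Q := by
    rw [← Real.sqrt_mul hb0.le, ← Real.sqrt_mul (by positivity)]
    exact Real.sqrt_le_sqrt hXq
  have hH : √(h ⬝ᵥ h) ≤ Q / s := by
    rw [← Real.sqrt_div hq0]
    exact Real.sqrt_le_sqrt hHq
  have hEl : g / (2 * b) * (Q * Q) ≤ E := by
    refine le_trans ?_ hE
    rw [← hQq]
    calc g / (2 * b) * q ≤ g / (2 * b) * (b * pm * ∑ i, (h i - c) ^ 2) := by gcongr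
      _ = _ := by field_simp
  -- The bound on α makes the quadratic part half of the lower bound `hEl`, so it can be absorbed.
  have hEu : E ≤ g / (4 * b) * (Q * Q) + η * Q / s := by
    refine hE'.trans ?_
    calc _ ≤ g / (4 * (r * b)) * ((r * s * Q) * (Q / s)) + η * (Q / s) := by gcongr
      _ = _ := by field_simp
  have hfin : g / (4 * b) * (Q * Q) ≤ η * Q / s := by
    have : g / (2 * b) * (Q * Q) = 2 * (g / (4 * b) * (Q * Q)) := by field_simp; ring
    linarith
  refine hX.trans ?_
  rcases hQ0.eq_or_lt with h0 | h0
  · rw [← h0, mul_zero]; positivity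
  · have h2 : g / (4 * b) * Q ≤ η / s := by
      refine le_of_mul_le_mul_right ?_ h0
      calc _ = g / (4 * b) * (Q * Q) := by ring
        _ ≤ η * Q / s := hfin
        _ = _ := by ring
    have h3 : Q ≤ η / s * (4 * b) / g := by
      rw [le_div_iff₀ hg]
      rw [div_mul_eq_mul_div, div_le_iff₀ (by positivity)] at h2
      linarith
    calc r * s * Q ≤ r * s * (η / s * (4 * b) / g) := by gcongr
      _ = _ := by field_simp

lemma btlProb_add_btlProb {w : Fin n → ℝ} (hw : ∀ i, 0 < w i) (i j : Fin n) :
    btlProb w j i = 1 - btlProb w i j := by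
  have h1 := hw i
  have h2 := hw j
  rw [btlProb, btlProb, add_comm (w j)]
  field_simp
  ring

lemma div_le_dynRange (w : Fin n → ℝ) (i j : Fin n) : w i / w j ≤ dynRange w :=
  le_ciSup (f := fun p : Fin n × Fin n => w p.1 / w p.2) (Set.finite_range _).bddAbove (i, j)

lemma one_le_dynRange {w : Fin n → ℝ} (i : Fin n) (hw : 0 < w i) : 1 ≤ dynRange w := by
  have := div_le_dynRange w i i
  rwa [div_self hw.ne'] at this

/-- Here pm is the smallest normalized weight. The last bound holds because w_i w_j / (w_i + w_j) is
half a harmonic mean. -/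
lemma exists_normalizedWeights_bounds [NeZero n] {w : Fin n → ℝ} (hw : ∀ i, 0 < w i) :
    ∃ pm, 0 < pm ∧
      (∀ i, pm ≤ normalizedWeights w i ∧ normalizedWeights w i ≤ dynRange w * pm) ∧
      ∀ i j, pm / 2 ≤ normalizedWeights w i * btlProb w i j := by
  obtain ⟨i₀, -, hi₀⟩ := Finset.exists_min_image univ w ⟨0, Finset.mem_univ _⟩
  have hW : 0 < ∑ k, w k := Finset.sum_pos (fun i _ => hw i) ⟨0, Finset.mem_univ _⟩
  refine ⟨w i₀ / ∑ k, w k, div_pos (hw _) hW, fun i => ⟨?_, ?_⟩, fun i j => ?_⟩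
  · rw [normalizedWeights]
    gcongr
    exact hi₀ i (Finset.mem_univ _)
  · rw [normalizedWeights, mul_div_assoc']
    gcongr
    exact (div_le_iff₀ (hw i₀)).1 (div_le_dynRange w i i₀)
  · rw [normalizedWeights, btlProb, div_right_comm, div_mul_div_comm, mul_comm (∑ k, w k),
      ← div_div (w i * w j)]
    refine div_le_div_of_nonneg_right ?_ hW.le
    have h1 := hi₀ i (Finset.mem_univ _)
    have h2 := hi₀ j (Finset.mem_univ _)
    have := hw i
    have := hw j
    rw [div_le_div_iff₀ two_pos (by positivity)]
    nlinarith

lemma normalizedWeights_btlProb_symm (w : Fin n → ℝ) (i j : Fin n) :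
    normalizedWeights w i * btlProb w i j = normalizedWeights w j * btlProb w j i := by
  rw [normalizedWeights, normalizedWeights, btlProb, btlProb, add_comm (w j)]
  ring

end Deterministic

/-! ### Error of a stationary distribution in terms of drift and noise -/

section Error

variable {n T L : ℕ} {G : Fin (T + 1) → SimpleGraph (Fin n)} {δ t d M : ℝ} {w : ℝ → Fin n → ℝ}

lemma avgWinRate_const (hL : 1 ≤ L) (f : Fin n → Fin n → ℝ) {i j : Fin n}
    (h : (unionGraph G δ t).Adj i j) :
    avgWinRate G δ t (fun _ i j (_ : Fin L) => f i j) i j = f i j := by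
  have := avgWinRate_mem_Icc (y := fun _ i j (_ : Fin L) => f i j) hL h (a := f i j) (b := f i j)
    fun _ _ _ => ⟨le_rfl, le_rfl⟩
  exact le_antisymm this.2 this.1

/-- The edge form of the difference between the averaged and the instantaneous win
probabilities. -/
lemma abs_edgeForm_bias_le (hL : 1 ≤ L) (hT : 0 < T) (hw : PosWeights w) (hM : 0 ≤ M)
    (hδ : 0 ≤ δ) (hlip : LipschitzOutcomes w M) (ht : t ∈ Set.Icc (0 : ℝ) 1) (u v : Fin n → ℝ) :
    |edgeForm (avgWinRate G δ t fun s i j (_ : Fin L) =>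
      btlProb (w (gridTime T s)) i j - btlProb (w t) i j) u v| ≤
      2 * (M * δ / T) * dMax (unionGraph G δ t) * (√(u ⬝ᵥ u) * √(v ⬝ᵥ v)) := by
  classical
  have hT' : (0 : ℝ) < T := by exact_mod_cast hT
  have hgrid : ∀ s, gridTime T s ∈ Set.Icc (0 : ℝ) 1 := by
    intro s
    rw [gridTime]
    refine ⟨by positivity, (div_le_one hT').2 ?_⟩
    exact_mod_cast Nat.lt_succ_iff.1 s.2
  refine abs_edgeForm_le (unionGraph G δ t) (avgWinRate_antisymm fun s i j l _ => ?_)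
    (by positivity) (fun i j => ?_) u v
  · rw [btlProb_add_btlProb (hw _ (hgrid s)) i j, btlProb_add_btlProb (hw _ ht) i j]; ring
  · by_cases h : (unionGraph G δ t).Adj i j
    · rw [SimpleGraph.adjMatrix_apply, if_pos h, mul_one, abs_le, ← Set.mem_Icc]
      refine avgWinRate_mem_Icc hL h fun s hs _ => ?_
      rw [Set.mem_Icc, ← abs_le]
      refine (hlip _ (hgrid s) _ ht i j h.ne).trans ?_
      have hs' : |t - gridTime T s| ≤ δ / T := by
        have := (mem_pairNbhd.1 hs).1
        simpa [nbhd] using this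
      rw [abs_sub_comm, mul_div_assoc]
      gcongr
    · rw [avgWinRate_eq_zero h, SimpleGraph.adjMatrix_apply, if_neg h]; simp

open scoped Classical in
/-- The error of a stationary distribution in terms of bounds on the noise. -/
lemma stationary_error_le [NeZero n] (hn : 2 ≤ n) (hL : 1 ≤ L) (hT : 0 < T) (hw : PosWeights w)
    (hM : 0 ≤ M) (hδ : 0 ≤ δ) (hlip : LipschitzOutcomes w M) (ht : t ∈ Set.Icc (0 : ℝ) 1)
    (hmin : 0 < dMin (unionGraph G δ t)) (hξ : 0 < spectralGap (unionGraph G δ t)) (hd : 0 < d)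
    {y : Fin (T + 1) → Fin n → Fin n → Fin L → ℝ} {α η : ℝ} (hη : 0 ≤ η)
    (hop : ∀ u v : Fin n → ℝ, |edgeForm (avgWinRate G δ t fun s i j l =>
      y s i j l - btlProb (w (gridTime T s)) i j) u v| ≤ α * (√(u ⬝ᵥ u) * √(v ⬝ᵥ v)))
    (hvec : ∀ v : Fin n → ℝ, |edgeForm (avgWinRate G δ t fun s i j l =>
      y s i j l - btlProb (w (gridTime T s)) i j) (normalizedWeights (w t)) v| ≤ η * √(v ⬝ᵥ v))
    (hsmall : 2 * (M * δ / T) * dMax (unionGraph G δ t) + α ≤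
      spectralGap (unionGraph G δ t) * dMin (unionGraph G δ t) /
        (4 * (√(dynRange (w t)) * dynRange (w t))))
    {p : Fin n → ℝ} (hp : IsStationary (estMatrix G δ t d y) p) :
    l2norm (p - normalizedWeights (w t)) ≤
      4 * (√(dynRange (w t)) * dynRange (w t)) /
        (spectralGap (unionGraph G δ t) * dMin (unionGraph G δ t)) *
      (2 * (M * δ / T) * dMax (unionGraph G δ t) * l2norm (normalizedWeights (w t)) + η) := by
  have hT' : (0 : ℝ) < T := by exact_mod_cast hT
  have hwt := hw t ht
  obtain ⟨pm, hpm, hbd, hcond⟩ := exists_normalizedWeights_bounds hwt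
  have hb := one_le_dynRange 0 (hwt 0)
  set H := unionGraph G δ t with hH
  set b := dynRange (w t)
  set q := normalizedWeights (w t) with hq
  have hq0 : ∀ i, 0 < q i := fun i => hpm.trans_le (hbd i).1
  set x := p - q with hx
  set h : Fin n → ℝ := fun i => x i / q i with hh
  have hxh : ∀ i, x i = q i * h i := fun i => by
    rw [hh]; field_simp [(hq0 i).ne']
  have hqsum : ∑ i, q i = 1 := by
    rw [hq]
    simp only [normalizedWeights]
    rw [← Finset.sum_div, div_self]
    exact (Finset.sum_pos (fun i _ => hwt i) ⟨0, Finset.mem_univ _⟩).ne'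
  have hxsum : ∑ i, x i = 0 := by
    simp [hx, Finset.sum_sub_distrib, hp.2.1, hqsum]
  set e := avgWinRate G δ t fun _ i j (_ : Fin L) => btlProb (w t) i j with he
  set ε := avgWinRate G δ t fun s i j l => y s i j l - btlProb (w (gridTime T s)) i j with hε
  set β := avgWinRate G δ t fun s i j (_ : Fin L) =>
    btlProb (w (gridTime T s)) i j - btlProb (w t) i j with hβ
  -- Reversible rates at time t, sampling noise, and drift in time.
  have hdec : avgWinRate G δ t y = e + (ε + β) := by
    ext i j
    rw [Pi.add_apply, Pi.add_apply, Pi.add_apply, Pi.add_apply, he, hε, hβ,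
      avgWinRate_sub y (fun s i j l => btlProb (w (gridTime T s)) i j),
      avgWinRate_sub (fun s i j l => btlProb (w (gridTime T s)) i j)
        (fun s i j l => btlProb (w t) i j)]
    ring
  have hrev : ∀ i j, q i * e i j = q j * e j i := by
    intro i j
    by_cases hij : H.Adj i j
    · rw [he, avgWinRate_const hL _ hij, avgWinRate_const hL _ hij.symm]
      exact normalizedWeights_btlProb_symm (w t) i j
    · rw [he, avgWinRate_eq_zero hij, avgWinRate_eq_zero fun h => hij h.symm]; simp
  have hstat : edgeForm (avgWinRate G δ t y) p h = 0 := by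
    have h1 := dotProduct_estMatrix_mulVec (G := G) (δ := δ) (t := t) (d := d) y p h
    rw [dotProduct_mulVec, hp.2.2] at h1
    have : edgeForm (avgWinRate G δ t y) p h / d = 0 := by linarith
    simpa [hd.ne'] using this
  have hpx : p = x + q := by rw [hx]; simp
  -- Insert p = x + q; the term e(q, h) vanishes because q is stationary for e.
  have hbal : -edgeForm e x h = edgeForm ε x h + edgeForm β x h + edgeForm ε q h +
      edgeForm β q h := by
    rw [hdec, hpx, edgeForm_add_left, edgeForm_add_weight, edgeForm_add_weight,
      edgeForm_add_weight, edgeForm_add_weight, edgeForm_eq_zero_of_reversible hrev] at hstat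
    linarith
  have hdeg : ∀ i, dMin H ≤ H.degree i := fun i => H.minDegree_le_degree i
  obtain ⟨c, hc⟩ := exists_spectralGap_mul_le_dirichlet H hn (fun i => hmin.trans_le (hdeg i)) hξ h
  have hdir : -edgeForm e x h = (∑ i, ∑ j, q i * e i j * (h i - h j) ^ 2) / 2 := by
    have : x = fun i => q i * h i := funext hxh
    nth_rewrite 1 [this]
    rw [edgeForm_mul_of_reversible hrev, neg_neg]
  have hlow : pm / 2 * (spectralGap H * dMin H) * ∑ i, (h i - c) ^ 2 ≤ -edgeForm e x h := by
    have h1 : spectralGap H * dMin H * ∑ i, (h i - c) ^ 2 ≤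
        spectralGap H * ∑ i, H.degree i * (h i - c) ^ 2 := by
      rw [mul_assoc, Finset.mul_sum]
      refine mul_le_mul_of_nonneg_left (Finset.sum_le_sum fun i _ => ?_) hξ.le
      refine mul_le_mul_of_nonneg_right ?_ (sq_nonneg _)
      exact_mod_cast hdeg i
    have h2 : pm / 2 * ((∑ i, ∑ j, H.adjMatrix ℝ i j * (h i - h j) ^ 2) / 2) ≤
        (∑ i, ∑ j, q i * e i j * (h i - h j) ^ 2) / 2 := by
      rw [mul_div_assoc', Finset.mul_sum]
      refine div_le_div_of_nonneg_right (Finset.sum_le_sum fun i _ => ?_) zero_le_two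
      rw [Finset.mul_sum]
      refine Finset.sum_le_sum fun j _ => ?_
      by_cases hij : H.Adj i j
      · rw [he, avgWinRate_const hL _ hij, SimpleGraph.adjMatrix_apply, if_pos hij, one_mul]
        exact mul_le_mul_of_nonneg_right (hcond i j) (sq_nonneg _)
      · rw [he, avgWinRate_eq_zero hij, SimpleGraph.adjMatrix_apply, if_neg hij]; simp
    rw [hdir]
    refine le_trans ?_ h2
    rw [mul_assoc]
    exact mul_le_mul_of_nonneg_left (h1.trans hc) (by positivity)
  have hbias := abs_edgeForm_bias_le (G := G) hL hT hw hM hδ hlip ht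
  set m := 2 * (M * δ / T) * dMax H with hm
  have hm0 : 0 ≤ m := by positivity
  have hup : -edgeForm e x h ≤ (m + α) * (√(x ⬝ᵥ x) * √(h ⬝ᵥ h)) +
      (m * √(q ⬝ᵥ q) + η) * √(h ⬝ᵥ h) := by
    rw [hbal]
    have h1 := (le_abs_self _).trans (hop x h)
    have h2 := (le_abs_self _).trans (hbias x h)
    have h3 := (le_abs_self _).trans (hvec h)
    have h4 := (le_abs_self _).trans (hbias q h)
    linarith
  rw [l2norm_eq, l2norm_eq]
  exact norm_le_of_dirichlet_le hb hpm hbd hxh hxsum (by positivity) hlow hup hsmall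
    (by positivity)

end Error

/-! ### Numerical constants and probabilities -/

lemma sqrt_mul_self_le_rpow {b : ℝ} (hb : 1 ≤ b) : √b * b ≤ b ^ (7 / 2 : ℝ) := by
  have hb0 : 0 < b := by linarith
  calc √b * b = b ^ (1 / 2 + 1 : ℝ) := by
        rw [Real.rpow_add hb0, Real.rpow_one, ← Real.sqrt_eq_rpow]
    _ ≤ _ := Real.rpow_le_rpow_of_exponent_le hb (by norm_num)

/-- The argument costs only b^(3/2) and b^(5/2); the exponents 7/2 and 9/2 of the theorem are larger
and b ≥ 1. -/
lemma sqrt_mul_self_mul_self_le_rpow {b : ℝ} (hb : 1 ≤ b) : √b * b * b ≤ b ^ (9 / 2 : ℝ) := by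
  have hb0 : 0 < b := by linarith
  calc √b * b * b = b ^ (1 / 2 + 1 + 1 : ℝ) := by
        rw [Real.rpow_add hb0, Real.rpow_add hb0, Real.rpow_one, ← Real.sqrt_eq_rpow]
    _ ≤ _ := Real.rpow_le_rpow_of_exponent_le hb (by norm_num)

lemma two_le_of_dMin_pos {n : ℕ} {H : SimpleGraph (Fin n)} (h : 0 < dMin H) : 2 ≤ n := by
  classical
  have h1 : 0 < dMax H := h.trans_le (dMin_le_dMax H)
  rcases Nat.lt_or_ge n 2 with hn | hn
  · have : Subsingleton (Fin n) := Fin.subsingleton_iff_le_one.2 (by omega)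
    rw [dMax, SimpleGraph.maxDegree_of_subsingleton] at h1
    exact absurd h1 (lt_irrefl _)
  · exact hn

lemma exists_adj_of_dMin_pos {n : ℕ} {H : SimpleGraph (Fin n)} (h : 0 < dMin H) :
    ∃ i j, H.Adj i j := by
  classical
  have hn := two_le_of_dMin_pos h
  have h1 : 0 < H.degree ⟨0, by omega⟩ := h.trans_le (H.minDegree_le_degree _)
  obtain ⟨j, hj⟩ := (H.degree_pos_iff_exists_adj _).1 h1
  exact ⟨_, j, hj⟩

lemma exp_eleven_le : Real.exp 11 ≤ 3 ^ 11 := by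
  have h : Real.exp 11 = Real.exp 1 ^ 11 := by rw [← Real.exp_nat_mul]; norm_num
  rw [h]
  exact pow_le_pow_left₀ (Real.exp_pos _).le Real.exp_one_lt_three.le 11

/-- The operator norm bound of the noise is dominated by the threshold in the theorem. -/
lemma sqrt_noise_opNorm_le {n m : ℕ} (hn : 2 ≤ n) (hm : m = ⌈Real.log n⌉₊) {D L Nm NM d : ℝ}
    (hD : 0 < D) (hL : 0 < L) (hNm : 0 < Nm) (hNM : Nm ≤ NM) (hd : 0 < d) :
    √(Real.exp 11 * (2 * m * (4 * D / (Nm * L)))) ≤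
      d * (2000 * √(NM * D * Real.log n / (L * d ^ 2 * Nm ^ 2))) := by
  have hlog : 0.69 ≤ Real.log n := by
    have h2 : Real.log 2 ≤ Real.log n := Real.log_le_log two_pos (by exact_mod_cast hn)
    linarith [Real.log_two_gt_d9]
  -- The 1 lost in rounding up is at most (3/2) log n, since log n ≥ 0.69.
  have hm' : (m : ℝ) ≤ 5 / 2 * Real.log n := by
    have := (Nat.ceil_lt_add_one (by linarith : 0 ≤ Real.log n)).le
    rw [hm]; linarith
  refine Real.sqrt_le_iff.2 ⟨by positivity, ?_⟩
  rw [mul_pow, mul_pow, Real.sq_sqrt (by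
    have : 0 < NM := hNm.trans_le hNM
    have : 0 < Real.log n := by linarith
    positivity)]
  have he := exp_eleven_le
  calc Real.exp 11 * (2 * m * (4 * D / (Nm * L)))
      ≤ 3 ^ 11 * (2 * (5 / 2 * Real.log n) * (4 * D / (Nm * L))) := by gcongr
    -- The constant 2000 comes from 20 · 3^11 = 3542940 ≤ 2000².
    _ ≤ 2000 ^ 2 * (Real.log n * (D / (Nm * L))) := by
        have : 0 ≤ Real.log n * (D / (Nm * L)) := by
          have : 0 < Real.log n := by linarith
          positivity
        calc _ = (3 ^ 11 * 20) * (Real.log n * (D / (Nm * L))) := by ring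
          _ ≤ _ := mul_le_mul_of_nonneg_right (by norm_num) this
    _ ≤ 2000 ^ 2 * (Real.log n * (D / (Nm * L) * (NM / Nm))) := by
        have h1 : 1 ≤ NM / Nm := (one_le_div hNm).2 hNM
        have : 0 < Real.log n := by linarith
        gcongr
        exact le_mul_of_one_le_right (by positivity) h1
    _ = _ := by field_simp

/-- The noise vector bound relative to the norm of the target. -/
lemma sqrt_noise_vector_le {n : ℕ} {D L Nm NM b pm P : ℝ} (hD : 0 < D) (hL : 0 < L)
    (hNm : 0 < Nm) (hNM : Nm ≤ NM) (hb : 0 < b) (hP : 0 ≤ P) (hpm : n * pm ^ 2 ≤ P ^ 2) :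
    √(11 * n * (8 * (b * pm) ^ 2 * D / (Nm * L))) ≤ 10 * b * P * √(NM * D / (L * Nm ^ 2)) := by
  have hNM0 : 0 < NM := hNm.trans_le hNM
  refine Real.sqrt_le_iff.2 ⟨by positivity, ?_⟩
  rw [mul_pow _ (√_), Real.sq_sqrt (by positivity)]
  calc 11 * n * (8 * (b * pm) ^ 2 * D / (Nm * L)) = 88 * b ^ 2 * (n * pm ^ 2) * (D / (Nm * L)) := by
        ring
    _ ≤ 100 * b ^ 2 * P ^ 2 * (D / (Nm * L) * (NM / Nm)) := by
        have h1 : 1 ≤ NM / Nm := (one_le_div hNm).2 hNM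
        gcongr
        · norm_num
        · exact le_mul_of_one_le_right (by positivity) h1
    _ = _ := by field_simp; ring

lemma exp_neg_le_inv_pow {n k : ℕ} (hn : 0 < n) {x : ℝ} (hx : Real.log n ≤ x) :
    Real.exp (-k * x) ≤ ((n : ℝ) ^ k)⁻¹ := by
  have hn' : (0 : ℝ) < n := by exact_mod_cast hn
  rw [← Real.exp_log hn', ← Real.exp_nat_mul, ← Real.exp_neg, Real.exp_le_exp]
  have : (k : ℝ) * Real.log n ≤ k * x := by gcongr
  linarith

/-- The exponent 11 pays for the dimension: 2n · n^(-11) + n^(-10) = 3n^(-10). -/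
lemma noise_probability_le {n m : ℕ} (hn : 2 ≤ n) (hm : m = ⌈Real.log n⌉₊) :
    2 * n * Real.exp (-11 * m) + Real.exp (-10 * n) ≤ 3 / (n : ℝ) ^ 10 := by
  have hn' : (0 : ℝ) < n := by exact_mod_cast (by omega : 0 < n)
  have h1 := exp_neg_le_inv_pow (n := n) (k := 11) (by omega) (hm ▸ Nat.le_ceil (Real.log n))
  have h2 := exp_neg_le_inv_pow (n := n) (k := 10) (by omega)
    ((Real.log_le_sub_one_of_pos hn').trans (by linarith : (n : ℝ) - 1 ≤ n))
  push_cast at h1 h2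
  calc _ ≤ 2 * n * ((n : ℝ) ^ 11)⁻¹ + ((n : ℝ) ^ 10)⁻¹ := by gcongr
    _ = _ := by field_simp; norm_num

lemma card_mul_sq_le_dotProduct {n : ℕ} {p : Fin n → ℝ} {pm : ℝ} (hpm : 0 ≤ pm)
    (hp : ∀ i, pm ≤ p i) : n * pm ^ 2 ≤ p ⬝ᵥ p := by
  calc (n : ℝ) * pm ^ 2 = ∑ _i : Fin n, pm * pm := by simp [pow_two]
    _ ≤ _ := Finset.sum_le_sum fun i _ => mul_le_mul (hp i) (hp i) hpm (hpm.trans (hp i))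

/-- The bound of the theorem, from the error bound in terms of the bias and the noise. -/
lemma relative_error_le {X P b g d D E a S η : ℝ} (hP : 0 < P) (hb : 1 ≤ b) (hg : 0 < g)
    (hD : 0 < D) (hDE : D ≤ E) (hDd : D ≤ d) (ha : 0 ≤ a) (hS : 0 ≤ S)
    (hX : X ≤ 4 * (√b * b) / g * (2 * a * D * P + η)) (hη : η ≤ 10 * b * P * S) :
    X / P ≤ 32 * (a * E * b ^ (7 / 2 : ℝ) * d / (g * D)) +
      8 * 10 * (b ^ (9 / 2 : ℝ) / g) * S := by
  have hb0 : 0 < b := by linarith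
  have h7 := sqrt_mul_self_le_rpow hb
  have h9 := sqrt_mul_self_mul_self_le_rpow hb
  have hE0 : 0 < E := hD.trans_le hDE
  -- Uses D² ≤ E d.
  have hDD : a * D ≤ a * E * d / D := by
    rw [le_div_iff₀ hD, mul_assoc, mul_assoc]
    gcongr
  rw [div_le_iff₀ hP]
  calc X ≤ 4 * (√b * b) / g * (2 * a * D * P + η) := hX
    _ ≤ 4 * (√b * b) / g * (2 * a * D * P + 10 * b * P * S) := by gcongr
    _ = (8 * ((√b * b) * (a * D) / g) + 40 * (√b * b * b / g) * S) * P := by ring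
    _ ≤ (32 * (b ^ (7 / 2 : ℝ) * (a * E * d / D) / g) + 80 * (b ^ (9 / 2 : ℝ) / g) * S) * P := by
        have hd0 : 0 < d := hD.trans_le hDd
        gcongr <;> norm_num
    _ = _ := by field_simp; ring

end DynRank

end

/-! ### Proof of the theorem -/

theorem theorem1 :
    ∃ c₁ C₁ C₂ K : ℝ, 0 < c₁ ∧ 15 ≤ C₁ ∧ 1 ≤ C₂ ∧ 0 < K ∧
      ∀ (n T L : ℕ) (w : ℝ → Fin n → ℝ) (M : ℝ) (G : Fin (T + 1) → SimpleGraph (Fin n))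
        (t δ d : ℝ) (Ω : Type*) [MeasurableSpace Ω] (μ : Measure Ω) [IsProbabilityMeasure μ]
        (Y : Fin (T + 1) → Fin n → Fin n → Fin L → Ω → ℝ),
        -- the model
        1 ≤ L →
        DynRank.PosWeights w →
        0 ≤ M →
        DynRank.LipschitzOutcomes w M →
        DynRank.IsBTLSample μ w G Y →
        -- the assumptions on `t`, `δ`, `n`, the union graph and the normalization `d`
        t ∈ Set.Icc (0 : ℝ) 1 →
        δ ∈ Set.Icc (1 / 2 : ℝ) T →
        c₁ * Real.log n ≤ n →
        0 < DynRank.dMin (DynRank.unionGraph G δ t) →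
        0 < DynRank.spectralGap (DynRank.unionGraph G δ t) →
        (DynRank.dMax (DynRank.unionGraph G δ t) : ℝ) ≤ d →
        C₁ * √((DynRank.Nmax G δ t : ℝ) * DynRank.dMax (DynRank.unionGraph G δ t) * Real.log n /
              (L * d ^ 2 * (DynRank.Nmin G δ t : ℝ) ^ 2))
            + 4 * (M * δ * DynRank.numEdges (DynRank.unionGraph G δ t) /
              (T * DynRank.dMax (DynRank.unionGraph G δ t)))
          ≤ DynRank.spectralGap (DynRank.unionGraph G δ t) *
              DynRank.dMin (DynRank.unionGraph G δ t) /
              (8 * d * DynRank.dynRange (w t) ^ (7 / 2 : ℝ)) →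
        -- the estimator exists, and the error bound holds with high probability
        (∀ ω, ∃ p, DynRank.IsStationary
          (DynRank.estMatrix G δ t d (fun s i j l => Y s i j l ω)) p) ∧
        1 - K / (n : ℝ) ^ 10 ≤ μ.real {ω | ∀ p : Fin n → ℝ,
          DynRank.IsStationary (DynRank.estMatrix G δ t d (fun s i j l => Y s i j l ω)) p →
          DynRank.l2norm (p - DynRank.normalizedWeights (w t)) /
              DynRank.l2norm (DynRank.normalizedWeights (w t))
            ≤ 32 * (M * δ * DynRank.numEdges (DynRank.unionGraph G δ t) *
                  DynRank.dynRange (w t) ^ (7 / 2 : ℝ) * d /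
                (T * DynRank.spectralGap (DynRank.unionGraph G δ t) *
                  DynRank.dMin (DynRank.unionGraph G δ t) *
                  DynRank.dMax (DynRank.unionGraph G δ t)))
              + 8 * C₂ * (DynRank.dynRange (w t) ^ (9 / 2 : ℝ) /
                (DynRank.spectralGap (DynRank.unionGraph G δ t) *
                  DynRank.dMin (DynRank.unionGraph G δ t))) *
                √((DynRank.Nmax G δ t : ℝ) * DynRank.dMax (DynRank.unionGraph G δ t) /
                  (L * (DynRank.Nmin G δ t : ℝ) ^ 2))} := by
  -- The values 2000, 10 and 3 come from `sqrt_noise_opNorm_le`, `sqrt_noise_vector_le` and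
  -- `noise_probability_le`.
  refine ⟨1, 2000, 10, 3, one_pos, by norm_num, by norm_num, by norm_num, ?_⟩
  intro n T L w M G t δ d Ω _ μ _ Y hL hw hM hlip hY ht hδ _ hmin hξ hd hcond
  classical
  have hn := DynRank.two_le_of_dMin_pos hmin
  have : NeZero n := ⟨by omega⟩
  obtain ⟨i₁, j₁, hadj⟩ := DynRank.exists_adj_of_dMin_pos hmin
  have hmax := hmin.trans_le (DynRank.dMin_le_dMax _)
  have hDE := DynRank.dMax_le_numEdges _ hmax
  have hNm := DynRank.Nmin_pos hadj
  have hNM := DynRank.Nmin_le_Nmax hadj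
  have hT' : (0 : ℝ) < T := by linarith [hδ.1, hδ.2]
  have hT : 0 < T := by exact_mod_cast hT'
  have hδ0 : 0 ≤ δ := by linarith [hδ.1]
  have hL' : (0 : ℝ) < L := by exact_mod_cast hL
  have hmax' : (0 : ℝ) < DynRank.dMax (DynRank.unionGraph G δ t) := by exact_mod_cast hmax
  have hmin' : (0 : ℝ) < DynRank.dMin (DynRank.unionGraph G δ t) := by exact_mod_cast hmin
  have hNm' : (0 : ℝ) < DynRank.Nmin G δ t := by exact_mod_cast hNm
  have hNM' : (DynRank.Nmin G δ t : ℝ) ≤ DynRank.Nmax G δ t := by exact_mod_cast hNM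
  have hDE' : (DynRank.dMax (DynRank.unionGraph G δ t) : ℝ) ≤
      DynRank.numEdges (DynRank.unionGraph G δ t) := by exact_mod_cast hDE
  have hd0 : 0 < d := hmax'.trans_le hd
  have hwt := hw t ht
  have hb := DynRank.one_le_dynRange 0 (hwt 0)
  have hb0 : 0 < DynRank.dynRange (w t) := by linarith
  refine ⟨fun ω => DynRank.exists_isStationary
    (DynRank.estMatrix_nonneg hL (fun s i j l h => ?_) hd0 hd) (DynRank.estMatrix_row_sum _), ?_⟩
  · rcases hY.binary s i j l ω h with h' | h' <;> simp [h']
  obtain ⟨pm, hpm, hbd, -⟩ := DynRank.exists_normalizedWeights_bounds hwt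
  set m := ⌈Real.log n⌉₊ with hm
  have hlog : 0 < Real.log n := Real.log_pos (by exact_mod_cast hn)
  have hm0 : m ≠ 0 := (Nat.ceil_pos.2 hlog).ne'
  have hbad₁ := hY.measure_noise_opNorm (δ := δ) (t := t) hL hmax hNm hm0
  have hbad₂ := hY.measure_noise_vector (δ := δ) (t := t) hL hmax hNm
    (p := DynRank.normalizedWeights (w t)) (b := DynRank.dynRange (w t) * pm) (by positivity)
    fun i => ⟨hpm.le.trans (hbd i).1, (hbd i).2⟩
  have hprob := DynRank.noise_probability_le hn hm
  set D : ℝ := (DynRank.dMax (DynRank.unionGraph G δ t) : ℝ)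
  set Nm : ℝ := (DynRank.Nmin G δ t : ℝ)
  set NM : ℝ := (DynRank.Nmax G δ t : ℝ)
  set E : ℝ := (DynRank.numEdges (DynRank.unionGraph G δ t) : ℝ)
  set b := DynRank.dynRange (w t)
  set q := DynRank.normalizedWeights (w t)
  set R := Real.exp 11 * (2 * m * (4 * D / (Nm * L))) with hR
  set V := 11 * n * (8 * (b * pm) ^ 2 * D / (Nm * L)) with hV
  set bad₁ := {ω | ¬ ∀ u v : Fin n → ℝ, DynRank.edgeForm (DynRank.avgWinRate G δ t
    (DynRank.centeredOutcome w Y ω)) u v ^ 2 ≤ R * ((u ⬝ᵥ u) * (v ⬝ᵥ v))} with hb₁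
  set bad₂ := {ω | ¬ ∀ v : Fin n → ℝ, DynRank.edgeForm (DynRank.avgWinRate G δ t
    (DynRank.centeredOutcome w Y ω)) q v ^ 2 ≤ V * (v ⬝ᵥ v)} with hb₂
  have hR0 : 0 ≤ R := by positivity
  have hV0 : 0 ≤ V := by positivity
  set good := {ω | ∀ p : Fin n → ℝ, DynRank.IsStationary
    (DynRank.estMatrix G δ t d (fun s i j l => Y s i j l ω)) p → _} with hgood
  -- Covering the whole space and using subadditivity avoids any measurability of the three sets.
  suffices hcover : ∀ ω, ω ∉ bad₁ → ω ∉ bad₂ → ω ∈ good by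
    have hun : (Set.univ : Set Ω) ⊆ good ∪ (bad₁ ∪ bad₂) := by
      intro ω _
      by_cases h1 : ω ∈ bad₁
      · exact Or.inr (Or.inl h1)
      · by_cases h2 : ω ∈ bad₂
        · exact Or.inr (Or.inr h2)
        · exact Or.inl (hcover ω h1 h2)
    have h1 := (measureReal_mono (μ := μ) hun).trans (measureReal_union_le _ _)
    have h2 := measureReal_union_le (μ := μ) bad₁ bad₂
    rw [probReal_univ] at h1
    linarith
  intro ω h1 h2 p hp
  have h1' := not_not.1 h1
  have h2' := not_not.1 h2
  have hop : ∀ u v : Fin n → ℝ, |DynRank.edgeForm (DynRank.avgWinRate G δ t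
      (DynRank.centeredOutcome w Y ω)) u v| ≤ √R * (√(u ⬝ᵥ u) * √(v ⬝ᵥ v)) := by
    intro u v
    rw [← Real.sqrt_mul (DynRank.dotProduct_self_nonneg_real u), ← Real.sqrt_mul hR0]
    exact Real.abs_le_sqrt (h1' u v)
  have hvec : ∀ v : Fin n → ℝ, |DynRank.edgeForm (DynRank.avgWinRate G δ t
      (DynRank.centeredOutcome w Y ω)) q v| ≤ √V * √(v ⬝ᵥ v) := by
    intro v
    rw [← Real.sqrt_mul hV0]
    exact Real.abs_le_sqrt (h2' v)
  set g := DynRank.spectralGap (DynRank.unionGraph G δ t) *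
    DynRank.dMin (DynRank.unionGraph G δ t) with hg
  have hg0 : 0 < g := by positivity
  have hRle := DynRank.sqrt_noise_opNorm_le hn hm hmax' hL' hNm' hNM' hd0
  -- Multiply the hypothesis by d: the right side becomes g / (8 b^(7/2)), the first term dominates
  -- √R, and the second dominates the drift because D ≤ d and D ≤ E.
  have hsmall : 2 * (M * δ / T) * D + √R ≤ g / (4 * (√b * b)) := by
    have h7 := DynRank.sqrt_mul_self_le_rpow hb
    have hbias : M * δ / T * D ≤ d * (M * δ * E / (T * D)) := by
      have e : d * (M * δ * E / (T * D)) = M * δ / T * (d * (E / D)) := by field_simp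
      rw [e]
      have hED : 1 ≤ E / D := (one_le_div hmax').2 hDE'
      have : D ≤ d * (E / D) := hd.trans (le_mul_of_one_le_right hd0.le hED)
      gcongr
    have hbias0 : 0 ≤ M * δ / T * D := by positivity
    have hmul := mul_le_mul_of_nonneg_left hcond hd0.le
    have hgd : d * (g / (8 * d * b ^ (7 / 2 : ℝ))) = g / (8 * b ^ (7 / 2 : ℝ)) := by
      field_simp
    rw [hgd, mul_add] at hmul
    have hlast : g / (8 * b ^ (7 / 2 : ℝ)) ≤ g / (4 * (√b * b)) := by
      have : 0 < √b := Real.sqrt_pos.2 hb0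
      gcongr
      norm_num
    linarith
  have herr := DynRank.stationary_error_le hn hL hT hw hM hδ0 hlip ht hmin hξ hd0
    (Real.sqrt_nonneg V) hop hvec hsmall hp
  have hq0 := DynRank.card_mul_sq_le_dotProduct hpm.le fun i => (hbd i).1
  have hqpos : 0 < q ⬝ᵥ q := lt_of_lt_of_le (by positivity) hq0
  have hP : 0 < DynRank.l2norm q := by rw [DynRank.l2norm_eq]; exact Real.sqrt_pos.2 hqpos
  have hη := DynRank.sqrt_noise_vector_le (n := n) (pm := pm) (P := DynRank.l2norm q) hmax' hL'
    hNm' hNM' hb0 hP.le (by rw [DynRank.l2norm_eq, Real.sq_sqrt hqpos.le]; exact hq0)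
  have hfin := DynRank.relative_error_le hP hb hg0 hmax' hDE' hd
    (by positivity : 0 ≤ M * δ / T) (Real.sqrt_nonneg _) herr hη
  refine hfin.trans (le_of_eq ?_)
  congr 2
  rw [hg]
  field_simp
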